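/- Let $X$ be a Polish space and let $\mathcal F(X)$ be the set of all closed subsets of $X$ with the Effros Borel structure, that is, the (standard Borel) $\sigma$-algebra generated by the sets $\{F: F\cap U\neq\emptyset\}$, $U\subset X$ open. An arc is a set homeomorphic to $[0,1]$; a possibly degenerate arc is an arc or a singleton $\{a\}$, the latter having $a$ as its only endpoint. Write $e(J)$ for the set of endpoints of $J$, and let $\hat{\mathcal J}(X)$ be the set of possibly degenerate arcs in $X$, as a subspace of the space of compact subsets of $X$ with the Vietoris topology. For $F\subset X$ let $E_F$ be the set of pairs $(x,y)$ such that $e(J)=\{x,y\}$ for some possibly degenerate arc $J\subset F$; this is an equivalence relation on $F$, whose classes are the arc-components of $F$, and $F$ is arc-connected if $E_F=F^2$. Let $\mathcal C_{arc}(X)\subset\mathcal F(X)$ be the set of all arc-connected closed subsets of $X$. A (simple) triod is the union of three arcs with a common endpoint $c$, any two of which meet only at $c$; a set $F\subset X$ is atriodic if no arc-component of $F$ contains a triod. A Jordan curve is a set homeomorphic to the unit circle. For $\mathcal G\subset\mathcal F(X)$ let $E_{\mathcal G}=\{(F,x,y)\in\mathcal G\times X^2: (x,y)\in E_F\}$.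 A uniform arc-lifting of $\mathcal G$ is a map $\Psi:E_{\mathcal G}\to\hat{\mathcal J}(X)$ such that $\Psi(F,x,y)\subset F$ and $e(\Psi(F,x,y))=\{x,y\}$ for all $(F,x,y)\in E_{\mathcal G}$. It is bianalytic if the inverse image of every open subset of $\hat{\mathcal J}(X)$ is the trace on $E_{\mathcal G}$ of an analytic subset of $\mathcal F(X)\times X^2$. **Corollary.** For any Polish space $X$, each of the following subsets of $\mathcal C_{arc}(X)$ is coanalytic in $\mathcal F(X)$ and admits a bianalytic uniform arc-lifting: a) the set of all atriodic arc-connected closed subsets of $X$; b) the set of all arc-connected closed subsets of $X$ that contain no Jordan curve. In particular, if $X$ is atriodic or contains no Jordan curve, then $\mathcal C_{arc}(X)$ is coanalytic. -/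

import Mathlib

open Set TopologicalSpace

namespace ArcConnected

/-! ### Descriptive set theory in standard Borel spaces -/

section Descriptive

variable {α Y : Type*} [MeasurableSpace α]

/-- A subset of a standard Borel space is analytic if it is analytic for a Polish topology which
generates the given Borel structure (the notion does not depend on the choice of that topology). -/
def IsAnalytic (A : Set α) : Prop :=
  ∃ τ : TopologicalSpace α, @PolishSpace α τ ∧ @BorelSpace α τ _ ∧ @MeasureTheory.AnalyticSet α τ A

/-- Complements of analytic sets. -/
def IsCoanalytic (A : Set α) : Prop := IsAnalytic Aᶜ

/-- The analytic subsets of a subspace `E` of `α`: the traces on `E` of the analytic subsets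
of `α`. -/
def IsAnalyticIn (E : Set α) (A : Set E) : Prop :=
  ∃ B : Set α, IsAnalytic B ∧ A = Subtype.val ⁻¹' B

/-- A map on a subspace `E` of `α` is bianalytic if the inverse image of every open set is an
analytic subset of `E`. -/
def IsBianalyticMap [TopologicalSpace Y] {E : Set α} (f : E → Y) : Prop :=
  ∀ U : Set Y, IsOpen U → IsAnalyticIn E (f ⁻¹' U)

end Descriptive

variable {X : Type*} [TopologicalSpace X]

/-- The Effros Borel structure on the space of all closed subsets of `X`. -/
instance effros : MeasurableSpace (Closeds X) :=
  MeasurableSpace.generateFrom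
    {S | ∃ U : Set X, IsOpen U ∧ S = {F : Closeds X | ((F : Set X) ∩ U).Nonempty}}

/-! ### Arcs, triods, Jordan curves -/

/-- An arc is a set homeomorphic to the unit interval. -/
def IsArc (J : Set X) : Prop := Nonempty (unitInterval ≃ₜ J)

/-- A possibly degenerate arc is an arc or a singleton. -/
def IsPDArc (J : Set X) : Prop := IsArc J ∨ ∃ a, J = {a}

/-- The set of endpoints of a possibly degenerate arc; a singleton is its own set of endpoints. -/
def endpoints (J : Set X) : Set X :=
  {x | (∃ h : unitInterval ≃ₜ J, x = h 0 ∨ x = h 1) ∨ J = {x}}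

/-- A Jordan curve is a set homeomorphic to the unit circle. -/
def IsJordanCurve (C : Set X) : Prop := Nonempty (Circle ≃ₜ C)

/-- A simple triod is the union of three arcs which have a common endpoint `c`, any two of which
meet only at `c`. -/
def IsTriod (T : Set X) : Prop :=
  ∃ (J : Fin 3 → Set X) (c : X), (∀ i, IsArc (J i) ∧ c ∈ endpoints (J i)) ∧
    (∀ i j, i ≠ j → J i ∩ J j = {c}) ∧ T = ⋃ i, J i

variable (X) in
/-- The space of possibly degenerate arcs in `X`, a subspace of the space of compact subsets of `X`
with the Vietoris topology. -/
abbrev PDArcs : Type _ := {J : Compacts X // IsPDArc (J : Set X)}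

/-! ### Arc-connection -/

/-- The arc-connection relation of a subset `S` of `X`. -/
def arcRel (S : Set X) : Set (X × X) :=
  {p | ∃ J : Set X, IsPDArc J ∧ J ⊆ S ∧ endpoints J = {p.1, p.2}}

/-- The arc-component of a point `x` in `S`. -/
def arcComponent (S : Set X) (x : X) : Set X := {y | (x, y) ∈ arcRel S}

/-- The triodic part of `S`: the union of the arc-components of `S` which contain a triod. -/
def triodicPart (S : Set X) : Set X :=
  ⋃ x ∈ {x ∈ S | ∃ T : Set X, IsTriod T ∧ T ⊆ arcComponent S x}, arcComponent S x

/-- A set is atriodic if its triodic part is empty. -/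
def IsAtriodic (S : Set X) : Prop := triodicPart S = ∅

/-- A set containing no Jordan curve. -/
def HasNoJordanCurve (S : Set X) : Prop := ∀ C : Set X, C ⊆ S → ¬ IsJordanCurve C

/-- A set is arc-connected if any two of its points are joined in it by a possibly degenerate
arc. -/
def IsArcConnected (S : Set X) : Prop := ∀ x ∈ S, ∀ y ∈ S, (x, y) ∈ arcRel S

variable (X) in
/-- The set of all arc-connected closed subsets of `X`. -/
def Carc : Set (Closeds X) := {F | IsArcConnected (F : Set X)}

variable (X) in
/-- The set of all atriodic arc-connected closed subsets of `X`. -/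
def CarcAtriodic : Set (Closeds X) := {F ∈ Carc X | IsAtriodic (F : Set X)}

variable (X) in
/-- The set of all arc-connected closed subsets of `X` that contain no Jordan curve. -/
def CarcNoJordan : Set (Closeds X) := {F ∈ Carc X | HasNoJordanCurve (F : Set X)}

/-! ### Uniform arc-liftings -/

/-- The set of all `(F, x, y)` with `F ∈ G` and `x, y` arc-connected in `F`. -/
def liftDomain (G : Set (Closeds X)) : Set (Closeds X × X × X) :=
  {p | p.1 ∈ G ∧ p.2 ∈ arcRel (p.1 : Set X)}

/-- A uniform arc-lifting of `G` assigns to every `(F, x, y)`, with `F ∈ G` and `x, y`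
arc-connected in `F`, a possibly degenerate arc contained in `F` with endpoints `x` and `y`. -/
def IsUniformArcLifting (G : Set (Closeds X)) (Ψ : liftDomain G → PDArcs X) : Prop :=
  ∀ p : liftDomain G, ((Ψ p).1 : Set X) ⊆ (p.1.1 : Set X) ∧
    endpoints ((Ψ p).1 : Set X) = {p.1.2.1, p.1.2.2}

end ArcConnected

namespace ArcConnected

/-! ### Closure properties of analytic sets -/

section Analytic

open MeasureTheory

variable {α β : Type*} [MeasurableSpace α] [MeasurableSpace β]

/-! The proof replaces arcs by points of a Polish space and then counts them. A sequence `g`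
separating points from closed sets yields a strictly increasing weight on nonempty compact sets.
Each arc with a chosen first endpoint therefore has exactly one parametrization along which the
weight of the initial segment grows linearly; constant paths play this role for singletons. The
possibly degenerate arcs from `x` to `y` in `F` thus correspond to the paths in `canonPaths g F x
y`, and this is a Borel condition on `(F, x, y, γ)`, the Effros structure being standard.

Case b). Two different arcs with the same endpoints contain a Jordan curve, and a Jordan curve gives
two arcs between any two of its points. So the family consists of those `F` in which any two points
are joined by exactly one canonical path (`isUniquelyJoined_iff`). By Lusin's unicity theorem
(`isCoanalytic_existsUnique`) the set of points with a one-point section is coanalytic, and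
quantifying over `x, y ∈ F` preserves this. The graph of the lifting is the Borel set of canonical
paths.

Case a). Containing a triod is analytic: three injective paths exist which leave a common point and
meet nowhere else. In an arc-connected set without triods, a Jordan curve is the whole set, and then
any two distinct points are joined by exactly two arcs. Hence `F` is either uniquely joined or
doubly joined. A Borel injection `ι` of the path space into `ℝ` orders each pair of canonical paths,
so "exactly two" becomes "exactly one increasing pair" and unicity applies again. The lifting takes
the only canonical path, or the one with smaller `ι`.

Lusin's theorem is itself derived here: Borel sets are injective projections of closed sets,
sections of closed sets are bodies of trees, and having a unique branch is expressed by comparing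
subtrees level by level. -/

theorem isAnalytic_exists [StandardBorelSpace α] [StandardBorelSpace β] {B : Set (α × β)}
    (hB : MeasurableSet B) : IsAnalytic {a | ∃ b, (a, b) ∈ B} := by
  obtain ⟨τ, hb, hp⟩ := ‹StandardBorelSpace α›.polish
  refine ⟨τ, hp, hb, ?_⟩
  convert hB.analyticSet_image (measurable_fst (α := α) (β := β)) using 1
  ext a
  simp

/-- The graph of a continuous parametrization by the Baire space is closed. This form no longer
mentions the topology hidden in `IsAnalytic`, so analyticity can be transferred to any Polish
topology with the same Borel sets. -/
theorem IsAnalytic.exists_measurableSet {A : Set α} (hA : IsAnalytic A) :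
    ∃ B : Set (α × (ℕ → ℕ)), MeasurableSet B ∧ A = {a | ∃ z, (a, z) ∈ B} := by
  obtain ⟨τ, hp, hb, hA⟩ := hA
  rw [AnalyticSet] at hA
  rcases hA with rfl | ⟨f, hf, rfl⟩
  · exact ⟨∅, MeasurableSet.empty, by simp⟩
  · refine ⟨{p | f p.2 = p.1},
      (isClosed_eq (hf.comp continuous_snd) continuous_fst).measurableSet, ?_⟩
    ext a
    simp

theorem IsAnalytic.analyticSet [TopologicalSpace α] [PolishSpace α] [BorelSpace α] {A : Set α}
    (hA : IsAnalytic A) : AnalyticSet A := by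
  obtain ⟨B, hB, rfl⟩ := hA.exists_measurableSet
  convert hB.analyticSet_image (measurable_fst (α := α) (β := ℕ → ℕ)) using 1
  ext a
  simp

theorem isAnalytic_iff_analyticSet [τ : TopologicalSpace α] [hp : PolishSpace α]
    [hb : BorelSpace α] {A : Set α} : IsAnalytic A ↔ AnalyticSet A :=
  ⟨IsAnalytic.analyticSet, fun h => ⟨τ, hp, hb, h⟩⟩

theorem isAnalytic_of_measurableSet [StandardBorelSpace α] {A : Set α} (hA : MeasurableSet A) :
    IsAnalytic A := by
  obtain ⟨τ, hb, hp⟩ := ‹StandardBorelSpace α›.polish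
  exact ⟨τ, hp, hb, hA.analyticSet⟩

theorem IsAnalytic.iUnion [StandardBorelSpace α] {ι : Type*} [Countable ι] {A : ι → Set α}
    (hA : ∀ i, IsAnalytic (A i)) : IsAnalytic (⋃ i, A i) := by
  obtain ⟨τ, hb, hp⟩ := ‹StandardBorelSpace α›.polish
  exact isAnalytic_iff_analyticSet.2 (AnalyticSet.iUnion fun i => (hA i).analyticSet)

theorem IsAnalytic.iInter [StandardBorelSpace α] {ι : Type*} [Countable ι] {A : ι → Set α}
    (hA : ∀ i, IsAnalytic (A i)) : IsAnalytic (⋂ i, A i) := by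
  obtain ⟨τ, hb, hp⟩ := ‹StandardBorelSpace α›.polish
  rcases isEmpty_or_nonempty ι with h | h
  · rw [iInter_of_empty]
    exact isAnalytic_of_measurableSet MeasurableSet.univ
  · exact isAnalytic_iff_analyticSet.2 (AnalyticSet.iInter fun i => (hA i).analyticSet)

theorem IsAnalytic.union [StandardBorelSpace α] {A B : Set α} (hA : IsAnalytic A)
    (hB : IsAnalytic B) : IsAnalytic (A ∪ B) := by
  rw [union_eq_iUnion]
  exact IsAnalytic.iUnion fun b => by cases b <;> assumption

theorem IsAnalytic.inter [StandardBorelSpace α] {A B : Set α} (hA : IsAnalytic A)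
    (hB : IsAnalytic B) : IsAnalytic (A ∩ B) := by
  rw [inter_eq_iInter]
  exact IsAnalytic.iInter fun b => by cases b <;> assumption

theorem IsAnalytic.exists_right [StandardBorelSpace α] [StandardBorelSpace β] {A : Set (α × β)}
    (hA : IsAnalytic A) : IsAnalytic {a | ∃ b, (a, b) ∈ A} := by
  obtain ⟨B, hB, rfl⟩ := hA.exists_measurableSet
  have hm : Measurable fun p : α × β × (ℕ → ℕ) => ((p.1, p.2.1), p.2.2) := by fun_prop
  convert isAnalytic_exists (hm hB) using 1
  ext a
  simp

theorem IsAnalytic.preimage [StandardBorelSpace α] [StandardBorelSpace β] {A : Set β}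
    (hA : IsAnalytic A) {f : α → β} (hf : Measurable f) : IsAnalytic (f ⁻¹' A) := by
  obtain ⟨B, hB, rfl⟩ := hA.exists_measurableSet
  have hm : Measurable fun p : α × (ℕ → ℕ) => (f p.1, p.2) := by fun_prop
  exact isAnalytic_exists (hm hB)

theorem IsCoanalytic.inter [StandardBorelSpace α] {A B : Set α} (hA : IsCoanalytic A)
    (hB : IsCoanalytic B) : IsCoanalytic (A ∩ B) := by
  rw [IsCoanalytic, compl_inter]
  exact IsAnalytic.union hA hB

theorem IsCoanalytic.union [StandardBorelSpace α] {A B : Set α} (hA : IsCoanalytic A)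
    (hB : IsCoanalytic B) : IsCoanalytic (A ∪ B) := by
  rw [IsCoanalytic, compl_union]
  exact IsAnalytic.inter hA hB

theorem IsCoanalytic.iUnion [StandardBorelSpace α] {ι : Type*} [Countable ι] {A : ι → Set α}
    (hA : ∀ i, IsCoanalytic (A i)) : IsCoanalytic (⋃ i, A i) := by
  rw [IsCoanalytic, compl_iUnion]
  exact IsAnalytic.iInter hA

theorem IsCoanalytic.iInter [StandardBorelSpace α] {ι : Type*} [Countable ι] {A : ι → Set α}
    (hA : ∀ i, IsCoanalytic (A i)) : IsCoanalytic (⋂ i, A i) := by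
  rw [IsCoanalytic, compl_iInter]
  exact IsAnalytic.iUnion hA

theorem IsCoanalytic.preimage [StandardBorelSpace α] [StandardBorelSpace β] {A : Set β}
    (hA : IsCoanalytic A) {f : α → β} (hf : Measurable f) : IsCoanalytic (f ⁻¹' A) :=
  IsAnalytic.preimage hA hf

theorem isCoanalytic_of_measurableSet [StandardBorelSpace α] {A : Set α} (hA : MeasurableSet A) :
    IsCoanalytic A :=
  isAnalytic_of_measurableSet hA.compl

theorem IsCoanalytic.forall_right [StandardBorelSpace α] [StandardBorelSpace β]
    {A : Set (α × β)} (hA : IsCoanalytic A) : IsCoanalytic {a | ∀ b, (a, b) ∈ A} := by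
  have h : {a | ∀ b, (a, b) ∈ A}ᶜ = {a | ∃ b, (a, b) ∈ Aᶜ} := by
    ext a
    simp
  rw [IsCoanalytic, h]
  exact IsAnalytic.exists_right hA

end Analytic

/-! ### Trees with a unique branch -/

section Tree

variable {S : Type*}

/-- A simulation of the part of a tree above a node by the part above another one. -/
def IsSimulation (T : Set (List S)) (R : List S → List S → Prop) : Prop :=
  ∀ u v, R u v → u ∈ T → v ∈ T ∧ ∀ c, ∃ d, R (c :: u) (d :: v)

/-- The part of the tree `T` above `s` is simulated by the part above `t`. -/
def Simulates (T : Set (List S)) (s t : List S) : Prop :=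
  ∃ R, IsSimulation T R ∧ R s t

theorem simulates_of_step {T : Set (List S)} {s t : List S}
    (h : s ∈ T → t ∈ T ∧ ∀ c, ∃ d, Simulates T (c :: s) (d :: t)) : Simulates T s t := by
  refine ⟨fun u v => (u = s ∧ v = t) ∨ Simulates T u v, ?_, .inl ⟨rfl, rfl⟩⟩
  rintro u v (⟨rfl, rfl⟩ | ⟨R, hR, huv⟩) hu
  · exact ⟨(h hu).1, fun c => ((h hu).2 c).imp fun d hd => .inr hd⟩
  · exact ⟨(hR u v huv hu).1, fun c => ((hR u v huv hu).2 c).imp fun d hd => .inr ⟨R, hR, hd⟩⟩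

/-- Non-simulation, with its arguments swapped, is itself a simulation: if it broke down at a pair,
`simulates_of_step` would produce the simulation assumed absent. `Simulates` thus behaves like
comparison of tree ranks, nodes outside `T` being lowest and nodes on infinite branches highest,
without any ordinals. -/
theorem simulates_total {T : Set (List S)} {s t : List S} (h : ¬ Simulates T s t) :
    Simulates T t s := by
  refine ⟨fun u v => ¬ Simulates T v u, ?_, h⟩
  intro u v huv hu
  by_contra! hcon
  refine huv (simulates_of_step fun hv => ⟨hu, fun c => ?_⟩)
  obtain ⟨d, hd⟩ := hcon hv
  exact ⟨d, hd c⟩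

theorem simulates_branch {T : Set (List S)} {w : ℕ → S} (hw : ∀ n, PiNat.res w n ∈ T)
    (s : List S) (n : ℕ) : Simulates T s (PiNat.res w n) := by
  refine ⟨fun _ v => ∃ k, v = PiNat.res w k, ?_, n, rfl⟩
  rintro u _ ⟨k, rfl⟩ -
  exact ⟨hw k, fun c => ⟨w k, k + 1, rfl⟩⟩

theorem exists_res_eq (t : List S) (d : ℕ → S) :
    ∃ w : ℕ → S, PiNat.res w t.length = t ∧ ∀ k, w (t.length + k) = d k := by
  induction t generalizing d with
  | nil => exact ⟨d, rfl, fun k => by simp⟩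
  | cons c t ih =>
    obtain ⟨w, hw, hd⟩ := ih (fun k => Nat.casesOn k c d)
    refine ⟨w, ?_, fun k => ?_⟩
    · have := hd 0
      simp only [add_zero] at this
      simp [PiNat.res_succ, hw, this]
    · have := hd (k + 1)
      simpa [add_assoc, add_comm 1 k] using this

/-- Answering the successive steps of the branch `w` with the simulation builds an infinite branch
through `t`. -/
theorem exists_branch_of_simulates {T : Set (List S)} (hT : ∀ c s, c :: s ∈ T → s ∈ T)
    {w : ℕ → S} (hw : ∀ n, PiNat.res w n ∈ T) {n : ℕ} {t : List S}
    (h : Simulates T (PiNat.res w n) t) :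
    ∃ w' : ℕ → S, PiNat.res w' t.length = t ∧ ∀ k, PiNat.res w' k ∈ T := by
  obtain ⟨R, hR, h⟩ := h
  have step : ∀ (m : ℕ) (v : List S), R (PiNat.res w m) v →
      ∃ d, R (PiNat.res w (m + 1)) (d :: v) := fun m v hv => (hR _ _ hv (hw m)).2 (w m)
  have : Nonempty S := ⟨w 0⟩
  choose! next hnext using step
  let v : ℕ → List S := fun k => Nat.rec t (fun k u => next (n + k) u :: u) k
  have hv : ∀ k, R (PiNat.res w (n + k)) (v k) := by
    intro k
    induction k with
    | zero => exact h
    | succ k ih => exact hnext _ _ ih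
  obtain ⟨w', hw', hd⟩ := exists_res_eq t fun k => next (n + k) (v k)
  have hv' : ∀ k, v k = PiNat.res w' (t.length + k) := by
    intro k
    induction k with
    | zero => exact hw'.symm
    | succ k ih =>
      change next (n + k) (v k) :: v k = w' (t.length + k) :: PiNat.res w' (t.length + k)
      rw [hd, ih]
  have hmem : ∀ k, PiNat.res w' (t.length + k) ∈ T := fun k => by
    rw [← hv']
    exact (hR _ _ (hv k) (hw _)).1
  have hdown : ∀ m k, PiNat.res w' (k + m) ∈ T → PiNat.res w' k ∈ T := by
    intro m
    induction m with
    | zero => exact fun k h => h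
    | succ m ih => exact fun k h => ih k (hT _ _ h)
  exact ⟨w', hw', fun k => hdown t.length k (by rw [add_comm]; exact hmem k)⟩

/-- A unique branch amounts to a strictly highest-ranked node on every level. A unique branch
supplies these nodes, since a node simulating one of them would carry another branch. Conversely the
strict maxima of successive levels fit together into a branch, and a second branch would simulate
them. The right side uses only countable quantifiers and negated simulations, so it is coanalytic
once `Simulates` is analytic. -/
theorem existsUnique_branch_iff [Nontrivial S] {T : Set (List S)}
    (hT : ∀ c s, c :: s ∈ T → s ∈ T) :
    (∃! w : ℕ → S, ∀ n, PiNat.res w n ∈ T) ↔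
      ∀ n, ∃ s : List S, s.length = n ∧ ∀ t, t.length = n → t ≠ s → ¬ Simulates T s t := by
  constructor
  · rintro ⟨w, hw, huniq⟩ n
    refine ⟨PiNat.res w n, PiNat.res_length w n, fun t ht hts hsim => hts ?_⟩
    obtain ⟨w', hw't, hw'⟩ := exists_branch_of_simulates hT hw hsim
    rw [← huniq w' hw', ← ht, hw't]
  · intro h
    choose s hlen hs using h
    have hmem : ∀ n, s (n + 1) ∈ T := by
      intro n
      obtain ⟨c, u, hcu⟩ : ∃ c u, s (n + 1) = c :: u := List.exists_cons_of_length_eq_add_one (hlen _)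
      -- A maximum outside `T` would be simulated vacuously by any other node of its level; the
      -- sibling `d :: u` is one.
      obtain ⟨d, hd⟩ := exists_ne c
      by_contra hn
      refine hs (n + 1) (d :: u) ?_ ?_ (simulates_of_step fun h => absurd h hn)
      · have := hlen (n + 1)
        rw [hcu] at this
        simpa using this
      · rw [hcu]
        simp [hd]
    have hstep : ∀ n, ∃ c, s (n + 1) = c :: s n := by
      intro n
      obtain ⟨c, t, hct⟩ : ∃ c t, s (n + 1) = c :: t := List.exists_cons_of_length_eq_add_one (hlen _)
      have htl : t.length = n := by
        have := hlen (n + 1)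
        rw [hct] at this
        simpa using this
      by_cases hts : t = s n
      · exact ⟨c, hts ▸ hct⟩
      exfalso
      -- If the parent `t` of the next maximum were not `s n`, every child of `s n` would be
      -- simulated by that maximum, so `s n` would be simulated by `t`.
      refine hs n t htl hts (simulates_of_step fun _ => ⟨hT c t (hct ▸ hmem n), fun c' => ⟨c, ?_⟩⟩)
      rw [← hct]
      refine simulates_total (hs (n + 1) (c' :: s n) (by simp [hlen]) ?_)
      rw [hct]
      simpa using fun _ => Ne.symm hts
    choose w hw using hstep
    have hsw : ∀ n, s n = PiNat.res w n := by
      intro n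
      induction n with
      | zero => exact List.length_eq_zero_iff.1 (hlen 0)
      | succ n ih => rw [hw, ih, PiNat.res_succ]
    have hbr : ∀ n, PiNat.res w n ∈ T := fun n => hT (w n) _ (by
      have := hmem n
      rwa [hsw] at this)
    refine ⟨w, hbr, fun w' hw' => ?_⟩
    by_contra hne
    obtain ⟨i, hi⟩ := Function.ne_iff.1 hne
    refine hs (i + 1) (PiNat.res w' (i + 1)) (PiNat.res_length _ _) ?_ (simulates_branch hw' _ _)
    rw [hsw]
    intro heq
    exact hi (PiNat.res_eq_res.1 heq i.lt_succ_self)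

end Tree

end ArcConnected

namespace ArcConnected

/-! ### Lusin's unicity theorem -/

section Unicity

/-- A set which is the injective projection of a closed subset of the product of the ambient space
with the Baire space. -/
def IsInjProjection {Y : Type*} [TopologicalSpace Y] (B : Set Y) : Prop :=
  ∃ C : Set (Y × (ℕ → ℕ)), IsClosed C ∧ (∀ y z z', (y, z) ∈ C → (y, z') ∈ C → z = z') ∧
    ∀ y, y ∈ B ↔ ∃ z, (y, z) ∈ C

section

variable {Y : Type*} [TopologicalSpace Y]

theorem isInjProjection_of_isClosed {B : Set Y} (hB : IsClosed B) : IsInjProjection B := by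
  refine ⟨{p | p.1 ∈ B ∧ p.2 = 0}, ?_, ?_, ?_⟩
  · exact (hB.preimage continuous_fst).inter (isClosed_eq continuous_snd continuous_const)
  · rintro y z z' ⟨-, h⟩ ⟨-, h'⟩
    exact h.trans h'.symm
  · exact fun y => ⟨fun h => ⟨0, h, rfl⟩, fun ⟨z, h, _⟩ => h⟩

theorem IsInjProjection.iInter {B : ℕ → Set Y} (hB : ∀ n, IsInjProjection (B n)) :
    IsInjProjection (⋂ n, B n) := by
  choose C hC hinj hproj using hB
  refine ⟨{p | ∀ n, (p.1, fun k => p.2 (Nat.pair n k)) ∈ C n}, ?_, ?_, ?_⟩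
  · simp only [ofPred_forall]
    exact isClosed_iInter fun n => (hC n).preimage (by fun_prop)
  · intro y z z' h h'
    ext m
    have := congrFun (hinj m.unpair.1 y _ _ (h m.unpair.1) (h' m.unpair.1)) m.unpair.2
    simpa using this
  · intro y
    simp only [mem_iInter, hproj]
    constructor
    · intro h
      choose z hz using h
      exact ⟨fun m => z m.unpair.1 m.unpair.2, fun n => by simpa using hz n⟩
    · rintro ⟨z, hz⟩ n
      exact ⟨_, hz n⟩

/-- The first entry of the witness records the index of the piece; disjointness makes it unique. -/
theorem IsInjProjection.iUnion_of_disjoint {B : ℕ → Set Y} (hB : ∀ n, IsInjProjection (B n))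
    (hdisj : ∀ y m n, y ∈ B m → y ∈ B n → m = n) : IsInjProjection (⋃ n, B n) := by
  choose C hC hinj hproj using hB
  refine ⟨{p | ∀ n, p.2 0 = n → (p.1, fun k => p.2 (k + 1)) ∈ C n}, ?_, ?_, ?_⟩
  · simp only [ofPred_forall, imp_iff_not_or]
    refine isClosed_iInter fun n => IsClosed.union ?_ ((hC n).preimage (by fun_prop))
    have : Continuous fun p : Y × (ℕ → ℕ) => p.2 0 := by fun_prop
    exact (isClosed_discrete {m : ℕ | ¬ m = n}).preimage this
  · intro y z z' h h'
    have h0 : z 0 = z' 0 :=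
      hdisj y _ _ ((hproj _ _).2 ⟨_, h _ rfl⟩) ((hproj _ _).2 ⟨_, h' _ rfl⟩)
    have := hinj _ y _ _ (h _ rfl) (h' _ h0.symm)
    ext m
    cases m with
    | zero => exact h0
    | succ m => exact congrFun this m
  · intro y
    simp only [mem_iUnion, hproj]
    constructor
    · rintro ⟨n, z, hz⟩
      exact ⟨fun k => Nat.casesOn k n z, by rintro _ rfl; exact hz⟩
    · rintro ⟨z, hz⟩
      exact ⟨z 0, _, hz _ rfl⟩

/-- The induction carries a set together with its complement, because injective projections are not
visibly closed under complements. Clopen generators start it, and unions are made disjoint before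
projecting. -/
theorem isInjProjection_of_generateFrom_isClopen {B : Set Y}
    (hB : @MeasurableSet Y (MeasurableSpace.generateFrom {s | IsClopen s}) B) :
    IsInjProjection B := by
  suffices h : IsInjProjection B ∧ IsInjProjection Bᶜ from h.1
  induction B, hB using MeasurableSpace.generateFrom_induction with
  | hC t ht =>
    exact ⟨isInjProjection_of_isClosed ht.1, isInjProjection_of_isClosed ht.2.isClosed_compl⟩
  | empty =>
    rw [compl_empty]
    exact ⟨isInjProjection_of_isClosed isClosed_empty, isInjProjection_of_isClosed isClosed_univ⟩
  | compl t ht ih =>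
    rw [compl_compl]
    exact ⟨ih.2, ih.1⟩
  | iUnion s hs ih =>
    refine ⟨?_, ?_⟩
    · have heq : ⋃ n, s n = ⋃ n, ⋂ i, if i < n then (s i)ᶜ else s n := by
        ext y
        simp only [mem_iUnion, mem_iInter]
        constructor
        · intro h
          classical
          refine ⟨Nat.find h, fun i => ?_⟩
          split_ifs with hi
          · exact Nat.find_min h hi
          · exact Nat.find_spec h
        · rintro ⟨n, hn⟩
          exact ⟨n, by simpa using hn n⟩
      rw [heq]
      refine IsInjProjection.iUnion_of_disjoint
        (fun n => IsInjProjection.iInter fun i => ?_) ?_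
      · split_ifs
        · exact (ih i).2
        · exact (ih n).1
      · intro y m n hm hn
        simp only [mem_iInter] at hm hn
        rcases lt_trichotomy m n with h | h | h
        · have h1 := hm m
          have h2 := hn m
          simp only [lt_irrefl, h, if_true, if_false] at h1 h2
          exact absurd h1 h2
        · exact h
        · have h1 := hm n
          have h2 := hn n
          simp only [lt_irrefl, h, if_true, if_false] at h1 h2
          exact absurd h2 h1
    · rw [compl_iUnion]
      exact IsInjProjection.iInter fun n => (ih n).2

end

/-- A relation on the countable set `List S` is a point of a standard Borel space of Boolean
matrices, and being a simulation is a countable list of Borel conditions on it. -/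
theorem isAnalytic_simulates {α S : Type*} [MeasurableSpace α] [StandardBorelSpace α] [Countable S]
    {T : α → Set (List S)} (hT : ∀ s, MeasurableSet {a | s ∈ T a}) (s t : List S) :
    IsAnalytic {a | Simulates (T a) s t} := by
  have hR : ∀ u v : List S, Measurable fun p : α × (List S → List S → Bool) => p.2 u v = true := by
    intro u v
    have : Measurable fun p : α × (List S → List S → Bool) => p.2 u v := by fun_prop
    exact measurableSet_setOfPred.1 (this (measurableSet_singleton true))
  have hTm : ∀ u : List S, Measurable fun p : α × (List S → List S → Bool) => u ∈ T p.1 :=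
    fun u => measurableSet_setOfPred.1 (measurable_fst (hT u))
  have hm : MeasurableSet {p : α × (List S → List S → Bool) |
      (∀ u v, p.2 u v = true → u ∈ T p.1 →
        v ∈ T p.1 ∧ ∀ c, ∃ d, p.2 (c :: u) (d :: v) = true) ∧ p.2 s t = true} := by
    refine measurableSet_setOfPred.2 (Measurable.and ?_ (hR s t))
    refine Measurable.forall fun u => Measurable.forall fun v => (hR u v).imp ((hTm u).imp ?_)
    exact (hTm v).and (Measurable.forall fun c => Measurable.exists fun d => hR _ _)
  convert isAnalytic_exists hm using 1
  ext a
  constructor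
  · rintro ⟨R, hR, hst⟩
    classical
    refine ⟨fun u v => decide (R u v), ?_⟩
    simpa [IsSimulation] using ⟨hR, hst⟩
  · rintro ⟨R, hR, hst⟩
    exact ⟨fun u v => R u v = true, hR, hst⟩

theorem isCoanalytic_existsUnique_branch {α S : Type*} [MeasurableSpace α] [StandardBorelSpace α]
    [Countable S] [Nontrivial S] {T : α → Set (List S)} (hT : ∀ s, MeasurableSet {a | s ∈ T a})
    (hdown : ∀ a c s, c :: s ∈ T a → s ∈ T a) :
    IsCoanalytic {a | ∃! w : ℕ → S, ∀ n, PiNat.res w n ∈ T a} := by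
  have : {a | ∃! w : ℕ → S, ∀ n, PiNat.res w n ∈ T a} =
      ⋂ n : ℕ, ⋃ s : {s : List S // s.length = n}, ⋂ t : {t : List S // t.length = n ∧ t ≠ s},
        {a | Simulates (T a) s t}ᶜ := by
    ext a
    simp [existsUnique_branch_iff (hdown a)]
  rw [this]
  refine IsCoanalytic.iInter fun n => IsCoanalytic.iUnion fun s => IsCoanalytic.iInter fun t => ?_
  rw [IsCoanalytic, compl_compl]
  exact isAnalytic_simulates hT _ _

/-- Taking closures in the definition of `T` makes membership of each node measurable in `a`; since
`D` is closed, the branches of `T a` are still exactly the section of `D` at `a`. -/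
theorem isCoanalytic_existsUnique_of_isClosed {α : Type*} [MeasurableSpace α]
    [TopologicalSpace α] [StandardBorelSpace α] [OpensMeasurableSpace α]
    {D : Set (α × (ℕ → ℕ × ℕ))} (hD : IsClosed D) :
    IsCoanalytic {a | ∃! w, (a, w) ∈ D} := by
  let T : α → Set (List (ℕ × ℕ)) := fun a =>
    {s | a ∈ closure {a' | ∃ w, PiNat.res w s.length = s ∧ (a', w) ∈ D}}
  have hbranch : ∀ a w, (∀ n, PiNat.res w n ∈ T a) ↔ (a, w) ∈ D := by
    intro a w
    constructor
    · intro h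
      rw [← hD.closure_eq, mem_closure_iff_nhds]
      intro t ht
      obtain ⟨u, hu, v, hv, huv⟩ := mem_nhds_prod_iff.1 ht
      obtain ⟨n, hn⟩ : ∃ n, ∀ w' : ℕ → ℕ × ℕ, PiNat.res w' n = PiNat.res w n → w' ∈ v := by
        obtain ⟨V, hVv, hVo, hwV⟩ := mem_nhds_iff.1 hv
        obtain ⟨_, ⟨x, n, rfl⟩, hwx, hxV⟩ :=
          (PiNat.isTopologicalBasis_cylinders fun _ => ℕ × ℕ).exists_subset_of_mem_open hwV hVo
        refine ⟨n, fun w' hw' => hVv (hxV ?_)⟩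
        rw [PiNat.cylinder_eq_res] at hwx ⊢
        exact hw'.trans hwx
      obtain ⟨a', ha'u, w', hw', ha'⟩ := mem_closure_iff_nhds.1 (h n) u hu
      rw [PiNat.res_length] at hw'
      exact ⟨(a', w'), huv ⟨ha'u, hn w' hw'⟩, ha'⟩
    · intro h n
      exact subset_closure ⟨w, by rw [PiNat.res_length], h⟩
  simp only [← hbranch]
  refine isCoanalytic_existsUnique_branch (fun s => isClosed_closure.measurableSet) ?_
  intro a c s h
  refine closure_mono ?_ h
  rintro a' ⟨w, hw, ha'⟩
  simp only [List.length_cons, PiNat.res_succ, List.cons.injEq] at hw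
  exact ⟨w, hw.2, ha'⟩

/-- As the auxiliary witness `z` is determined by `(a, b)`, uniqueness of `b` is the same as
uniqueness of the pair `(b, z)`, coded as a sequence in `ℕ × ℕ`. This reduces a Borel set to a
closed one. -/
theorem isCoanalytic_existsUnique_cantor {B : Set ((ℕ → Bool) × (ℕ → ℕ))} (hB : MeasurableSet B) :
    IsCoanalytic {a | ∃! b, (a, b) ∈ B} := by
  have hle : (inferInstance : MeasurableSpace ((ℕ → Bool) × (ℕ → ℕ))) ≤
      MeasurableSpace.generateFrom {s | IsClopen s} := by
    have h : @Measurable _ _ (MeasurableSpace.generateFrom {s | IsClopen s}) inferInstance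
        (id : (ℕ → Bool) × (ℕ → ℕ) → _) := by
      refine @Measurable.prodMk _ _ _ _ _ (_) _ _ ?_ ?_ <;>
      · refine @measurable_pi_lambda _ _ _ (_) _ _ fun n => ?_
        refine @measurable_to_countable' _ _ _ _ (_) _ fun x => ?_
        refine MeasurableSpace.measurableSet_generateFrom ?_
        first
        | exact (isClopen_discrete {x}).preimage
            (show Continuous fun p : (ℕ → Bool) × (ℕ → ℕ) => p.1 n by fun_prop)
        | exact (isClopen_discrete {x}).preimage
            (show Continuous fun p : (ℕ → Bool) × (ℕ → ℕ) => p.2 n by fun_prop)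
    intro s hs
    exact h hs
  obtain ⟨C, hC, hinj, hproj⟩ := isInjProjection_of_generateFrom_isClopen (hle B hB)
  have h := isCoanalytic_existsUnique_of_isClosed
    (D := {p : (ℕ → Bool) × (ℕ → ℕ × ℕ) | ((p.1, fun n => (p.2 n).1), fun n => (p.2 n).2) ∈ C})
    (hC.preimage (by fun_prop))
  convert h using 1
  ext a
  constructor
  · rintro ⟨b, hb, hb'⟩
    obtain ⟨z, hz⟩ := (hproj _).1 hb
    refine ⟨fun n => (b n, z n), hz, fun w hw => ?_⟩
    have h1 := hb' _ ((hproj _).2 ⟨_, hw⟩)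
    have h2 := hinj (a, b) _ z (by rw [← h1]; exact hw) hz
    ext n
    · exact congrFun h1 n
    · exact congrFun h2 n
  · rintro ⟨w, hw, hw'⟩
    refine ⟨fun n => (w n).1, (hproj _).2 ⟨_, hw⟩, fun b hb => ?_⟩
    obtain ⟨z, hz⟩ := (hproj _).1 hb
    rw [← hw' (fun n => (b n, z n)) hz]

/-- **Lusin's unicity theorem**: the set of points over which a Borel subset of a product has
exactly one point is coanalytic. -/
theorem isCoanalytic_existsUnique {α β : Type*} [MeasurableSpace α] [StandardBorelSpace α]
    [MeasurableSpace β] [StandardBorelSpace β] {B : Set (α × β)} (hB : MeasurableSet B) :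
    IsCoanalytic {a | ∃! b, (a, b) ∈ B} := by
  obtain ⟨e, he, hinj⟩ := MeasurableSpace.measurable_injection_nat_bool_of_countablySeparated α
  obtain ⟨f, hf, hinjf⟩ := MeasurableSpace.measurable_injection_nat_bool_of_countablySeparated β
  let g : β → ℕ → ℕ := fun b n => (f b n).toNat
  have hg : Measurable g := measurable_pi_lambda _ fun n =>
    (measurable_from_top (f := Bool.toNat)).comp ((measurable_pi_apply n).comp hf)
  have hinjg : Function.Injective g := by
    intro b b' h
    refine hinjf (funext fun n => ?_)
    have := congrFun h n
    simp only [g] at this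
    cases h1 : f b n <;> cases h2 : f b' n <;> simp_all
  -- By the Lusin–Souslin theorem, an injective Borel image of a Borel set is Borel.
  have hB' : MeasurableSet (Prod.map e g '' B) :=
    hB.image_of_measurable_injOn (he.prodMap hg) (hinj.prodMap hinjg).injOn
  convert (isCoanalytic_existsUnique_cantor hB').preimage he using 1
  ext a
  have key : ∀ c, (e a, c) ∈ Prod.map e g '' B ↔ ∃ b, g b = c ∧ (a, b) ∈ B := by
    intro c
    constructor
    · rintro ⟨⟨a', b⟩, hab, h⟩
      simp only [Prod.map_apply, Prod.mk.injEq] at h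
      exact ⟨b, h.2, hinj h.1 ▸ hab⟩
    · rintro ⟨b, rfl, hb⟩
      exact ⟨(a, b), hb, rfl⟩
  constructor
  · rintro ⟨b, hb, hb'⟩
    refine ⟨g b, (key _).2 ⟨b, rfl, hb⟩, fun c hc => ?_⟩
    obtain ⟨b'', rfl, hb''⟩ := (key c).1 hc
    rw [hb' b'' hb'']
  · rintro ⟨c, hc, hc'⟩
    obtain ⟨b, rfl, hb⟩ := (key c).1 hc
    exact ⟨b, hb, fun b'' hb'' => hinjg (hc' _ ((key _).2 ⟨b'', rfl, hb''⟩))⟩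

end Unicity

end ArcConnected

namespace ArcConnected

/-! ### The Effros Borel structure is standard -/

section Effros

variable {X : Type*} [TopologicalSpace X]

theorem standardBorelSpace_of_measurableEquiv {α β : Type*} [MeasurableSpace α] [MeasurableSpace β]
    [hβ : StandardBorelSpace β] (e : α ≃ᵐ β) : StandardBorelSpace α := by
  obtain ⟨τ, hb, hp⟩ := hβ.polish
  let : TopologicalSpace α := τ.induced e
  refine ⟨inferInstance, ⟨?_⟩, ?_⟩
  · rw [borel_comap, ← hb.measurable_eq, e.measurableEmbedding.comap_eq]
  · exact (e.toEquiv.toHomeomorphOfIsInducing ⟨rfl⟩).isClosedEmbedding.polishSpace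

theorem measurableSet_hits {U : Set X} (hU : IsOpen U) :
    MeasurableSet {F : Closeds X | ((F : Set X) ∩ U).Nonempty} :=
  MeasurableSpace.measurableSet_generateFrom ⟨U, hU, rfl⟩

open Classical in
/-- The code of a closed set: the set of indices of the basic open sets which it meets. -/
noncomputable def hitCode (U : ℕ → Set X) (F : Closeds X) (n : ℕ) : Bool :=
  decide ((F : Set X) ∩ U n).Nonempty

theorem hitCode_eq_true {U : ℕ → Set X} {F : Closeds X} {n : ℕ} :
    hitCode U F n = true ↔ ((F : Set X) ∩ U n).Nonempty := by
  simp [hitCode]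

theorem hitCode_injective {U : ℕ → Set X} (hU : IsTopologicalBasis (range U)) :
    Function.Injective (hitCode U) := by
  have key : ∀ F G : Closeds X, hitCode U F = hitCode U G → (F : Set X) ⊆ G := by
    intro F G h x hx
    by_contra hxG
    obtain ⟨_, ⟨n, rfl⟩, hxn, hn⟩ := hU.exists_subset_of_mem_open
      (show x ∈ (G : Set X)ᶜ from hxG) G.isClosed.isOpen_compl
    have h1 : hitCode U F n = true := hitCode_eq_true.2 ⟨x, hx, hxn⟩
    rw [h, hitCode_eq_true] at h1
    obtain ⟨y, hyG, hyn⟩ := h1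
    exact hn hyn hyG
  intro F G h
  exact SetLike.coe_injective ((key F G h).antisymm (key G F h.symm))

theorem comap_hitCode {U : ℕ → Set X} (hU : IsTopologicalBasis (range U)) :
    (effros : MeasurableSpace (Closeds X)) = MeasurableSpace.comap (hitCode U) inferInstance := by
  apply le_antisymm
  · refine MeasurableSpace.generateFrom_le ?_
    rintro _ ⟨O, hO, rfl⟩
    have : {F : Closeds X | ((F : Set X) ∩ O).Nonempty} =
        hitCode U ⁻¹' ⋃ n : {n // U n ⊆ O}, {s | s n = true} := by
      ext F
      simp only [mem_ofPred, mem_preimage, mem_iUnion, hitCode_eq_true]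
      constructor
      · rintro ⟨x, hxF, hxO⟩
        obtain ⟨_, ⟨n, rfl⟩, hxn, hn⟩ := hU.exists_subset_of_mem_open hxO hO
        exact ⟨⟨n, hn⟩, x, hxF, hxn⟩
      · rintro ⟨⟨n, hn⟩, x, hxF, hxn⟩
        exact ⟨x, hxF, hn hxn⟩
    rw [this]
    exact ⟨_, MeasurableSet.iUnion fun n => measurable_pi_apply _ (measurableSet_singleton true), rfl⟩
  · rw [← measurable_iff_comap_le]
    refine measurable_pi_lambda _ fun n => measurable_to_bool ?_
    convert! measurableSet_hits (hU.isOpen (mem_range_self n)) using 1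
    ext F
    exact hitCode_eq_true

/-- Any hit basic set contains arbitrarily small hit ones with closure inside it. Conversely,
completeness gives a point in the intersection of such a shrinking chain, and by monotonicity all
its basic neighbourhoods are in the code. The conditions are countable in number, so the range is
Borel. -/
theorem range_hitCode {X : Type*} [MetricSpace X] [CompleteSpace X] {U : ℕ → Set X}
    (hU : IsTopologicalBasis (range U)) :
    range (hitCode U) = {s | (∀ n m, U n ⊆ U m → s n = true → s m = true) ∧
      (∀ n, s n = true → (U n).Nonempty) ∧
      ∀ n k : ℕ, s n = true → ∃ m, s m = true ∧ closure (U m) ⊆ U n ∧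
        Bornology.IsBounded (U m) ∧ Metric.diam (U m) ≤ (1 / 2) ^ k} := by
  ext s
  constructor
  · rintro ⟨F, rfl⟩
    simp only [mem_ofPred, hitCode_eq_true]
    refine ⟨fun n m hnm h => h.mono (inter_subset_inter_right _ hnm),
      fun n h => h.mono inter_subset_right, ?_⟩
    rintro n k ⟨x, hxF, hxn⟩
    obtain ⟨ε, hε, hball⟩ := Metric.isOpen_iff.1 (hU.isOpen (mem_range_self n)) x hxn
    set r : ℝ := min (ε / 2) ((1 / 2) ^ k / 2) with hr
    have hr0 : 0 < r := by positivity
    obtain ⟨_, ⟨m, rfl⟩, hxm, hm⟩ := hU.exists_subset_of_mem_open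
      (Metric.mem_ball_self (x := x) hr0) Metric.isOpen_ball
    refine ⟨m, ⟨x, hxF, hxm⟩, ?_, Metric.isBounded_ball.subset hm, ?_⟩
    · refine (closure_mono hm).trans (Metric.closure_ball_subset_closedBall.trans
        ((Metric.closedBall_subset_ball ?_).trans hball))
      exact (min_le_left _ _).trans_lt (half_lt_self hε)
    · refine (Metric.diam_mono hm Metric.isBounded_ball).trans ((Metric.diam_ball hr0.le).trans ?_)
      have := min_le_right (ε / 2) ((1 / 2 : ℝ) ^ k / 2)
      linarith
  · rintro ⟨hmono, hne, hsmall⟩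
    refine ⟨⟨{x | ∀ n, x ∈ U n → s n = true}, ?_⟩, ?_⟩
    · simp only [ofPred_forall, imp_iff_not_or]
      exact isClosed_iInter fun n =>
        (hU.isOpen (mem_range_self n)).isClosed_compl.union isClosed_const
    · ext n
      rw [Bool.eq_iff_iff, hitCode_eq_true]
      constructor
      · rintro ⟨x, hx, hxn⟩
        exact hx n hxn
      · intro hn
        choose! next hs hcl hbd hdiam using hsmall
        let m : ℕ → ℕ := fun k => Nat.rec n (fun k j => next j k) k
        have hsm : ∀ k, s (m k) = true := by
          intro k
          induction k with
          | zero => exact hn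
          | succ k ih => exact hs _ _ ih
        have hanti : Antitone fun k => closure (U (m (k + 1))) :=
          antitone_nat_of_succ_le fun k => (hcl (m (k + 1)) (k + 1) (hsm (k + 1))).trans subset_closure
        obtain ⟨x, hx⟩ := Metric.nonempty_iInter_of_nonempty_biInter
          (s := fun k => closure (U (m (k + 1)))) (fun _ => isClosed_closure)
          (fun k => (hbd _ _ (hsm k)).closure)
          (fun N => by
            obtain ⟨y, hy⟩ := hne _ (hsm (N + 1))
            exact ⟨y, mem_iInter₂.2 fun k hk => hanti hk (subset_closure hy)⟩)
          (squeeze_zero (fun _ => Metric.diam_nonneg)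
            (fun k => (Metric.diam_closure (U (m (k + 1)))).trans_le (hdiam (m k) k (hsm k)))
            (tendsto_pow_atTop_nhds_zero_of_lt_one (by norm_num) (by norm_num)))
        have hxU : ∀ k, x ∈ U (m k) := fun k => hcl (m k) k (hsm k) (mem_iInter.1 hx k)
        refine ⟨x, fun j hj => ?_, hxU 0⟩
        obtain ⟨ε, hε, hball⟩ := Metric.isOpen_iff.1 (hU.isOpen (mem_range_self j)) x hj
        obtain ⟨k, hk⟩ := exists_pow_lt_of_lt_one hε (show (1 / 2 : ℝ) < 1 by norm_num)
        refine hmono (m (k + 1)) j (fun y hy => hball ?_) (hsm (k + 1))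
        exact (Metric.dist_le_diam_of_mem (hbd _ _ (hsm k)) hy (hxU (k + 1))).trans_lt
          ((hdiam _ _ (hsm k)).trans_lt hk)

instance [PolishSpace X] : StandardBorelSpace (Closeds X) := by
  let := upgradeIsCompletelyMetrizable X
  obtain ⟨U, hU⟩ := exists_seq_basis X
  have hrange : MeasurableSet (range (hitCode U)) := by
    rw [range_hitCode hU]
    have h : ∀ n, Measurable fun s : ℕ → Bool => s n = true := fun n =>
      measurableSet_setOfPred.1 ((measurable_pi_apply (X := fun _ : ℕ => Bool) n)
        (measurableSet_singleton true))
    refine measurableSet_setOfPred.2 (Measurable.and ?_ (Measurable.and ?_ ?_))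
    · exact Measurable.forall fun n => Measurable.forall fun m =>
        measurable_const.imp ((h n).imp (h m))
    · exact Measurable.forall fun n => (h n).imp measurable_const
    · exact Measurable.forall fun n => Measurable.forall fun k => (h n).imp
        (Measurable.exists fun m => (h m).and measurable_const)
  have := hrange.standardBorel
  let e : Closeds X ≃ range (hitCode U) := Equiv.ofInjective _ (hitCode_injective hU)
  have hm : Measurable (hitCode U) := by
    rw [measurable_iff_comap_le, comap_hitCode hU]
  let e' : Closeds X ≃ᵐ range (hitCode U) :=
    { e with
      measurable_toFun := hm.subtype_mk
      measurable_invFun := by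
        intro S hS
        rw [comap_hitCode hU] at hS
        obtain ⟨T, hT, rfl⟩ := hS
        refine ⟨T, hT, ?_⟩
        ext p
        change _ ↔ hitCode U (e.symm p) ∈ T
        rw [show hitCode U (e.symm p) = p from congrArg Subtype.val (e.apply_symm_apply p)]
        rfl }
  exact standardBorelSpace_of_measurableEquiv e'

end Effros

end ArcConnected

namespace ArcConnected

/-! ### Parametrizations of arcs -/

section Param

theorem homeomorph_unitInterval_strictMono_or_strictAnti (k : unitInterval ≃ₜ unitInterval) :
    (StrictMono k ∧ k 0 = 0 ∧ k 1 = 1) ∨ (StrictAnti k ∧ k 0 = 1 ∧ k 1 = 0) := by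
  obtain ⟨a, ha⟩ := k.surjective 0
  obtain ⟨b, hb⟩ := k.surjective 1
  rcases k.continuous.strictMono_of_inj_boundedOrder' k.injective with h | h
  · refine .inl ⟨h, le_antisymm ?_ bot_le, le_antisymm le_top ?_⟩
    · exact (h.monotone (bot_le (a := a))).trans ha.le
    · exact hb.ge.trans (h.monotone (le_top (a := b)))
  · refine .inr ⟨h, le_antisymm le_top ?_, le_antisymm ?_ bot_le⟩
    · exact hb.ge.trans (h.antitone (bot_le (a := b)))
    · exact (h.antitone (le_top (a := a))).trans ha.le

variable {X : Type*} [TopologicalSpace X]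

/-- `J` is an arc with endpoints `x` and `y`. -/
def ArcBetween (J : Set X) (x y : X) : Prop :=
  ∃ γ : C(unitInterval, X), Function.Injective γ ∧ range γ = J ∧ γ 0 = x ∧ γ 1 = y

theorem ArcBetween.symm {J : Set X} {x y : X} (h : ArcBetween J x y) : ArcBetween J y x := by
  obtain ⟨γ, hγ, rfl, rfl, rfl⟩ := h
  refine ⟨γ.comp ⟨unitInterval.symm, unitInterval.continuous_symm⟩,
    hγ.comp unitInterval.symm_bijective.1, ?_, by simp, by simp⟩
  exact unitInterval.symm_bijective.2.range_comp γ

theorem endpoints_singleton (a : X) : endpoints ({a} : Set X) = {a} := by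
  ext x
  constructor
  · rintro (⟨h, hx⟩ | h)
    · exact absurd (h.injective (Subsingleton.elim (h 0) (h 1))) zero_ne_one
    · exact (singleton_eq_singleton_iff.1 h).symm
  · rintro rfl
    exact .inr rfl

variable [T2Space X]

/-- An injective path is a homeomorphism onto its range. -/
noncomputable def homeomorphRange (γ : C(unitInterval, X)) (hγ : Function.Injective γ) :
    unitInterval ≃ₜ range γ :=
  (γ.continuous.isClosedEmbedding hγ).isEmbedding.toHomeomorph

theorem coe_homeomorphRange (γ : C(unitInterval, X)) (hγ : Function.Injective γ)
    (t : unitInterval) : (homeomorphRange γ hγ t : X) = γ t :=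
  rfl

/-- Two injective paths with the same range differ by a homeomorphism of the unit interval. -/
theorem exists_reparam {γ : C(unitInterval, X)} (hγ : Function.Injective γ)
    (h : unitInterval ≃ₜ range γ) : ∃ k : unitInterval ≃ₜ unitInterval, ∀ t, γ (k t) = h t := by
  refine ⟨h.trans (homeomorphRange γ hγ).symm, fun t => ?_⟩
  rw [← coe_homeomorphRange γ hγ]
  simp

theorem endpoints_range {γ : C(unitInterval, X)} (hγ : Function.Injective γ) :
    endpoints (range γ) = {γ 0, γ 1} := by
  ext x
  constructor
  · rintro (⟨h, hx⟩ | h)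
    · obtain ⟨k, hk⟩ := exists_reparam hγ h
      rw [← hk, ← hk] at hx
      rcases homeomorph_unitInterval_strictMono_or_strictAnti k with ⟨-, h0, h1⟩ | ⟨-, h0, h1⟩
      · rwa [h0, h1] at hx
      · rw [h0, h1] at hx
        exact hx.symm
    · have h0 : γ 0 ∈ ({x} : Set X) := h ▸ mem_range_self 0
      have h1 : γ 1 ∈ ({x} : Set X) := h ▸ mem_range_self 1
      exact absurd (hγ (h0.trans h1.symm)) zero_ne_one
  · rintro (rfl | rfl)
    · exact .inl ⟨homeomorphRange γ hγ, .inl rfl⟩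
    · exact .inl ⟨homeomorphRange γ hγ, .inr rfl⟩

theorem isArc_range {γ : C(unitInterval, X)} (hγ : Function.Injective γ) : IsArc (range γ) :=
  ⟨homeomorphRange γ hγ⟩

theorem ArcBetween.isArc {J : Set X} {x y : X} (h : ArcBetween J x y) : IsArc J := by
  obtain ⟨γ, hγ, rfl, rfl, rfl⟩ := h
  exact isArc_range hγ

theorem ArcBetween.endpoints_eq {J : Set X} {x y : X} (h : ArcBetween J x y) :
    endpoints J = {x, y} := by
  obtain ⟨γ, hγ, rfl, rfl, rfl⟩ := h
  exact endpoints_range hγ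

theorem IsArc.arcBetween {J : Set X} (hJ : IsArc J) {x y : X} (he : endpoints J = {x, y}) :
    ArcBetween J x y := by
  obtain ⟨h⟩ := hJ
  have key : ArcBetween J (h 0) (h 1) := by
    refine ⟨⟨fun t => h t, by fun_prop⟩, Subtype.val_injective.comp h.injective, ?_, rfl, rfl⟩
    ext z
    simp only [ContinuousMap.coe_mk, mem_range]
    exact ⟨fun ⟨t, ht⟩ => ht ▸ (h t).2, fun hz => ⟨h.symm ⟨z, hz⟩, by simp⟩⟩
  have h2 := key.endpoints_eq
  rw [he, pair_eq_pair_iff] at h2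
  rcases h2 with ⟨rfl, rfl⟩ | ⟨rfl, rfl⟩
  · exact key
  · exact key.symm

theorem isPDArc_and_endpoints_iff {J : Set X} {x y : X} :
    IsPDArc J ∧ endpoints J = {x, y} ↔ ArcBetween J x y ∨ (x = y ∧ J = {x}) := by
  constructor
  · rintro ⟨h | ⟨a, rfl⟩, he⟩
    · exact .inl (h.arcBetween he)
    · rw [endpoints_singleton] at he
      have hx : x ∈ ({a} : Set X) := he ▸ mem_insert _ _
      have hy : y ∈ ({a} : Set X) := he ▸ mem_insert_of_mem _ rfl
      obtain rfl : x = a := hx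
      exact .inr ⟨hy.symm, rfl⟩
  · rintro (h | ⟨rfl, rfl⟩)
    · exact ⟨.inl h.isArc, h.endpoints_eq⟩
    · exact ⟨.inr ⟨x, rfl⟩, by simp [endpoints_singleton]⟩

end Param

/-! ### Canonical parametrizations -/

section Canonical

variable {X : Type*} [TopologicalSpace X]

/-- A sequence of continuous functions which separates points from closed sets. -/
structure IsSeparatingSeq (g : ℕ → C(X, ℝ)) : Prop where
  nonneg : ∀ n x, 0 ≤ g n x
  le_one : ∀ n x, g n x ≤ 1
  exists_pos : ∀ K : Set X, IsClosed K → K.Nonempty → ∀ z ∉ K, ∃ n, 0 < g n z ∧ ∀ y ∈ K, g n y = 0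

theorem exists_isSeparatingSeq (X : Type*) [TopologicalSpace X] [PolishSpace X] :
    ∃ g : ℕ → C(X, ℝ), IsSeparatingSeq g := by
  let := upgradeIsCompletelyMetrizable X
  obtain ⟨U, hU⟩ := exists_seq_basis X
  refine ⟨fun n => ⟨fun x => min 1 (Metric.infDist x (U n)ᶜ), by fun_prop⟩, ?_, ?_, ?_⟩
  · exact fun n x => le_min zero_le_one Metric.infDist_nonneg
  · exact fun n x => min_le_left _ _
  · intro K hK ⟨y, hy⟩ z hz
    obtain ⟨_, ⟨n, rfl⟩, hzn, hn⟩ := hU.exists_subset_of_mem_open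
      (show z ∈ Kᶜ from hz) hK.isOpen_compl
    refine ⟨n, lt_min one_pos ?_, fun y' hy' => ?_⟩
    · refine ((hU.isOpen (mem_range_self n)).isClosed_compl.notMem_iff_infDist_pos
        ⟨y, fun h => hn h hy⟩).1 ?_
      simpa using hzn
    · have : Metric.infDist y' (U n)ᶜ = 0 := Metric.infDist_zero_of_mem fun h => hn h hy'
      simp [this]

/-- A strictly increasing function of compact sets. -/
noncomputable def setWeight (g : ℕ → C(X, ℝ)) (K : Set X) : ℝ :=
  ∑' n, (1 / 2 : ℝ) ^ n * sSup (g n '' K)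

theorem sSup_image_mem_Icc {g : ℕ → C(X, ℝ)} (hg : IsSeparatingSeq g) (n : ℕ) (K : Set X) :
    sSup (g n '' K) ∈ Icc (0 : ℝ) 1 := by
  refine ⟨Real.sSup_nonneg ?_, Real.sSup_le ?_ zero_le_one⟩
  · rintro _ ⟨x, -, rfl⟩
    exact hg.nonneg n x
  · rintro _ ⟨x, -, rfl⟩
    exact hg.le_one n x

theorem bddAbove_image_of_isSeparatingSeq {g : ℕ → C(X, ℝ)} (hg : IsSeparatingSeq g) (n : ℕ)
    (K : Set X) : BddAbove (g n '' K) := by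
  refine ⟨1, ?_⟩
  rintro _ ⟨x, -, rfl⟩
  exact hg.le_one n x

theorem norm_setWeight_term_le {g : ℕ → C(X, ℝ)} (hg : IsSeparatingSeq g) (n : ℕ) (K : Set X) :
    ‖(1 / 2 : ℝ) ^ n * sSup (g n '' K)‖ ≤ (1 / 2) ^ n := by
  have := sSup_image_mem_Icc hg n K
  rw [Real.norm_of_nonneg (mul_nonneg (by positivity) this.1)]
  exact mul_le_of_le_one_right (by positivity) this.2

theorem summable_setWeight {g : ℕ → C(X, ℝ)} (hg : IsSeparatingSeq g) (K : Set X) :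
    Summable fun n => (1 / 2 : ℝ) ^ n * sSup (g n '' K) :=
  Summable.of_norm_bounded summable_geometric_two fun n => norm_setWeight_term_le hg n K

/-- A point of `L` outside `K` is detected by some `g n` that vanishes on `K`, which makes one term
of the series strictly larger. -/
theorem setWeight_lt {g : ℕ → C(X, ℝ)} (hg : IsSeparatingSeq g) {K L : Set X} (hK : IsClosed K)
    (hne : K.Nonempty) (hKL : K ⊂ L) : setWeight g K < setWeight g L := by
  obtain ⟨z, hzL, hzK⟩ := exists_of_ssubset hKL
  obtain ⟨n, hn, hn0⟩ := hg.exists_pos K hK hne z hzK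
  refine Summable.tsum_lt_tsum (i := n) (fun m => ?_) ?_ (summable_setWeight hg K)
    (summable_setWeight hg L)
  · refine mul_le_mul_of_nonneg_left ?_ (by positivity)
    exact csSup_le_csSup (bddAbove_image_of_isSeparatingSeq hg m L) (hne.image _)
      (image_mono hKL.1)
  · gcongr
    calc sSup (g n '' K) ≤ 0 := Real.sSup_le (by rintro _ ⟨y, hy, rfl⟩; exact (hn0 y hy).le) le_rfl
      _ < g n z := hn
      _ ≤ sSup (g n '' L) := le_csSup (bddAbove_image_of_isSeparatingSeq hg n L) ⟨z, hzL, rfl⟩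

/-- The weight of an initial segment of a path. -/
noncomputable def pathWeight (g : ℕ → C(X, ℝ)) (γ : C(unitInterval, X)) (t : unitInterval) : ℝ :=
  setWeight g (γ '' Iic t)

/-- Rescaling replaces the varying interval by a fixed compact parameter space, which makes the
supremum in `pathWeight` jointly continuous in the path and the time. -/
theorem image_Iic_eq_range_mul (t : unitInterval) :
    Iic t = (fun s : unitInterval => t * s) '' univ := by
  ext s
  simp only [mem_Iic, image_univ, mem_range]
  constructor
  · intro h
    rcases eq_or_ne t 0 with rfl | ht
    · exact ⟨0, by simpa using (le_antisymm h bot_le).symm⟩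
    · have ht0 : (0 : ℝ) < t := lt_of_le_of_ne t.2.1 fun h => ht (Subtype.ext h.symm)
      refine ⟨⟨s / t, div_nonneg s.2.1 t.2.1, (div_le_one ht0).2 h⟩, Subtype.ext ?_⟩
      exact mul_div_cancel₀ _ ht0.ne'
  · rintro ⟨u, rfl⟩
    exact unitInterval.mul_le_left

theorem continuous_pathWeight {g : ℕ → C(X, ℝ)} (hg : IsSeparatingSeq g) :
    Continuous fun p : C(unitInterval, X) × unitInterval => pathWeight g p.1 p.2 := by
  refine continuous_tsum (fun n => ?_) summable_geometric_two
    fun n p => norm_setWeight_term_le hg n _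
  refine continuous_const.mul ?_
  simp only [image_Iic_eq_range_mul, image_image]
  refine IsCompact.continuous_sSup (K := univ)
    (f := fun (p : C(unitInterval, X) × unitInterval) s => g n (p.1 (p.2 * s))) isCompact_univ ?_
  change Continuous fun q : (C(unitInterval, X) × unitInterval) × unitInterval =>
    g n (q.1.1 (q.1.2 * q.2))
  fun_prop

theorem strictMono_pathWeight [T2Space X] {g : ℕ → C(X, ℝ)} (hg : IsSeparatingSeq g)
    {γ : C(unitInterval, X)} (hγ : Function.Injective γ) : StrictMono (pathWeight g γ) := by
  intro s t hst
  refine setWeight_lt hg (isClosed_Iic.isCompact.image γ.continuous).isClosed (nonempty_Iic.image γ) ?_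
  exact (hγ.injOn.image_ssubset_image_iff (subset_univ _) (subset_univ _)).2
    (Iic_ssubset_Iic.2 hst)

/-- A path is canonical if the weight grows linearly along the path. -/
def IsCanonical (g : ℕ → C(X, ℝ)) (γ : C(unitInterval, X)) : Prop :=
  ∀ t, pathWeight g γ t - pathWeight g γ 0 = t * (pathWeight g γ 1 - pathWeight g γ 0)

theorem isClosed_isCanonical {g : ℕ → C(X, ℝ)} (hg : IsSeparatingSeq g) :
    IsClosed {γ | IsCanonical g γ} := by
  have h : ∀ t, Continuous fun γ : C(unitInterval, X) => pathWeight g γ t := fun t =>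
    (continuous_pathWeight hg).comp (continuous_id.prodMk continuous_const)
  simp only [IsCanonical, ofPred_forall]
  exact isClosed_iInter fun t => isClosed_eq ((h t).sub (h 0))
    (continuous_const.mul ((h 1).sub (h 0)))

theorem pathWeight_comp {g : ℕ → C(X, ℝ)} {γ δ : C(unitInterval, X)}
    (e : unitInterval ≃o unitInterval) (h : ∀ t, δ t = γ (e t)) (t : unitInterval) :
    pathWeight g δ t = pathWeight g γ (e t) := by
  have : δ '' Iic t = γ '' Iic (e t) := by
    rw [← e.image_Iic, image_image]
    simp only [h]
  rw [pathWeight, pathWeight, this]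

/-- The weight, normalized to run from 0 to 1, is an increasing homeomorphism `φ` of the interval;
`γ` is composed with its inverse. -/
theorem exists_isCanonical [T2Space X] {g : ℕ → C(X, ℝ)} (hg : IsSeparatingSeq g)
    {γ : C(unitInterval, X)} (hγ : Function.Injective γ) :
    ∃ δ : C(unitInterval, X), Function.Injective δ ∧ IsCanonical g δ ∧ range δ = range γ ∧
      δ 0 = γ 0 ∧ δ 1 = γ 1 := by
  have hmono := strictMono_pathWeight hg hγ
  set D := pathWeight g γ 1 - pathWeight g γ 0 with hD
  have hDpos : 0 < D := sub_pos.2 (hmono zero_lt_one)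
  let φ : unitInterval → unitInterval := fun t =>
    ⟨(pathWeight g γ t - pathWeight g γ 0) / D,
      div_nonneg (sub_nonneg.2 (hmono.monotone bot_le)) hDpos.le,
      (div_le_one hDpos).2 (sub_le_sub_right (hmono.monotone le_top) _)⟩
  have hφmono : StrictMono φ := fun s t hst =>
    div_lt_div_of_pos_right (sub_lt_sub_right (hmono hst) _) hDpos
  have hφcont : Continuous φ := by
    refine Continuous.subtype_mk ?_ _
    have : Continuous fun t => pathWeight g γ t :=
      (continuous_pathWeight hg).comp (continuous_const.prodMk continuous_id)
    fun_prop
  have hφ0 : φ 0 = 0 := Subtype.ext (by simp [φ])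
  have hφ1 : φ 1 = 1 := Subtype.ext (by simp [φ, ← hD, hDpos.ne'])
  have hφsurj : Function.Surjective φ := by
    intro t
    have := mem_range_of_exists_le_of_exists_ge hφcont ⟨0, hφ0.trans_le (bot_le (a := t))⟩
      ⟨1, (le_top (a := t)).trans hφ1.ge⟩
    exact this
  let e := hφmono.orderIsoOfSurjective φ hφsurj
  have he : ∀ t, e t = φ t := fun t => rfl
  have he0 : e.symm 0 = 0 := by rw [OrderIso.symm_apply_eq, he, hφ0]
  have he1 : e.symm 1 = 1 := by rw [OrderIso.symm_apply_eq, he, hφ1]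
  let δ : C(unitInterval, X) := γ.comp ⟨e.symm, e.symm.continuous⟩
  refine ⟨δ, hγ.comp e.symm.injective, fun t => ?_, e.symm.surjective.range_comp γ, ?_, ?_⟩
  · have hw : ∀ t, pathWeight g δ t = pathWeight g γ (e.symm t) :=
      pathWeight_comp e.symm fun t => rfl
    have h1 : (e (e.symm t) : ℝ) = t := by rw [OrderIso.apply_symm_apply]
    rw [he] at h1
    simp only [φ] at h1
    rw [hw, hw, hw, he0, he1, ← hD, ← h1]
    field_simp
  · exact congrArg γ he0
  · exact congrArg γ he1

/-- The two paths differ by a homeomorphism `k` fixing 0, hence increasing, so initial segments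
correspond. Linearity of both weights then forces `k t = t`. -/
theorem IsCanonical.eq_of_range_eq [T2Space X] {g : ℕ → C(X, ℝ)} (hg : IsSeparatingSeq g)
    {γ δ : C(unitInterval, X)} (hγ : Function.Injective γ) (hδ : Function.Injective δ)
    (hcγ : IsCanonical g γ) (hcδ : IsCanonical g δ) (hr : range δ = range γ) (h0 : δ 0 = γ 0) :
    δ = γ := by
  obtain ⟨k, hk⟩ := exists_reparam hγ ((homeomorphRange δ hδ).trans (Homeomorph.setCongr hr))
  replace hk : ∀ t, γ (k t) = δ t := hk
  have hk0 : k 0 = 0 := hγ ((hk 0).trans h0)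
  obtain ⟨hmono, -, hk1⟩ : StrictMono k ∧ k 0 = 0 ∧ k 1 = 1 := by
    rcases homeomorph_unitInterval_strictMono_or_strictAnti k with h | ⟨-, h, -⟩
    · exact h
    · exact absurd (hk0.symm.trans h) zero_ne_one
  have hw : ∀ t, pathWeight g δ t = pathWeight g γ (k t) :=
    pathWeight_comp (hmono.orderIsoOfSurjective k k.surjective) fun t => (hk t).symm
  have hD : pathWeight g γ 1 - pathWeight g γ 0 ≠ 0 :=
    (sub_pos.2 (strictMono_pathWeight hg hγ zero_lt_one)).ne'
  ext t
  have h1 := hcδ t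
  rw [hw, hw, hw, hk0, hk1, hcγ (k t)] at h1
  rw [← hk, Subtype.ext (mul_right_cancel₀ hD h1)]

/-- The canonical parametrizations of the possibly degenerate arcs from `x` to `y` in `F`. -/
def canonPaths (g : ℕ → C(X, ℝ)) (F : Set X) (x y : X) : Set C(unitInterval, X) :=
  {γ | (Function.Injective γ ∨ ∀ s t, γ s = γ t) ∧ IsCanonical g γ ∧ γ 0 = x ∧ γ 1 = y ∧
    range γ ⊆ F}

theorem range_eq_singleton_of_const {γ : C(unitInterval, X)} (h : ∀ s t, γ s = γ t) :
    range γ = {γ 0} := by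
  ext x
  exact ⟨fun ⟨t, ht⟩ => ht ▸ h t 0, fun hx => ⟨0, hx.symm⟩⟩

theorem isPDArc_range_of_mem_canonPaths [T2Space X] {g : ℕ → C(X, ℝ)} {F : Set X} {x y : X}
    {γ : C(unitInterval, X)} (h : γ ∈ canonPaths g F x y) :
    IsPDArc (range γ) ∧ endpoints (range γ) = {x, y} := by
  obtain ⟨hγ | hγ, -, rfl, rfl, -⟩ := h
  · exact isPDArc_and_endpoints_iff.2 (.inl ⟨γ, hγ, rfl, rfl, rfl⟩)
  · exact isPDArc_and_endpoints_iff.2 (.inr ⟨hγ _ _, range_eq_singleton_of_const hγ⟩)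

theorem isCanonical_of_const {g : ℕ → C(X, ℝ)} {γ : C(unitInterval, X)} (h : ∀ s t, γ s = γ t) :
    IsCanonical g γ := by
  have : ∀ t, pathWeight g γ t = pathWeight g γ 0 := by
    intro t
    have him : ∀ t, γ '' Iic t = {γ 0} := fun t => by
      ext x
      exact ⟨fun ⟨s, _, hs⟩ => hs ▸ h s 0, fun hx => ⟨0, mem_Iic.2 bot_le, hx.symm⟩⟩
    rw [pathWeight, pathWeight, him, him]
  intro t
  rw [this t, this 1]
  ring

theorem exists_mem_canonPaths [T2Space X] {g : ℕ → C(X, ℝ)} (hg : IsSeparatingSeq g)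
    {F J : Set X} {x y : X} (hJF : J ⊆ F) (hJ : IsPDArc J) (he : endpoints J = {x, y}) :
    ∃ γ ∈ canonPaths g F x y, range γ = J := by
  rcases isPDArc_and_endpoints_iff.1 ⟨hJ, he⟩ with ⟨γ, hγ, rfl, rfl, rfl⟩ | ⟨rfl, rfl⟩
  · obtain ⟨δ, hδ, hc, hr, h0, h1⟩ := exists_isCanonical hg hγ
    exact ⟨δ, ⟨.inl hδ, hc, h0, h1, hr.trans_subset hJF⟩, hr⟩
  · refine ⟨ContinuousMap.const _ x, ⟨.inr fun s t => rfl, isCanonical_of_const fun s t => rfl,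
      rfl, rfl, ?_⟩, range_eq_singleton_of_const fun s t => rfl⟩
    rwa [range_eq_singleton_of_const fun s t => rfl]

theorem canonPaths_eq_of_range_eq [T2Space X] {g : ℕ → C(X, ℝ)} (hg : IsSeparatingSeq g)
    {F : Set X} {x y : X} {γ δ : C(unitInterval, X)} (hγ : γ ∈ canonPaths g F x y)
    (hδ : δ ∈ canonPaths g F x y) (hr : range γ = range δ) : γ = δ := by
  obtain ⟨hi, hc, h0, h1, -⟩ := hγ
  obtain ⟨hi', hc', h0', h1', -⟩ := hδ
  rcases hi with hi | hi <;> rcases hi' with hi' | hi'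
  · exact hc'.eq_of_range_eq hg hi' hi hc hr (h0.trans h0'.symm)
  · have := hi (h0.trans (h0'.symm.trans ((hi' 0 1).trans (h1'.trans h1.symm))))
    exact absurd this zero_ne_one
  · have := hi' (h0'.trans (h0.symm.trans ((hi 0 1).trans (h1.trans h1'.symm))))
    exact absurd this zero_ne_one
  · ext t
    rw [hi t 0, hi' t 0, h0, h0']

end Canonical

end ArcConnected

namespace ArcConnected

/-! ### Subarcs -/

section Subarcs

variable {X : Type*} [TopologicalSpace X]

theorem ArcBetween.ne {J : Set X} {x y : X} (h : ArcBetween J x y) : x ≠ y := by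
  obtain ⟨γ, hγ, rfl, rfl, rfl⟩ := h
  exact hγ.ne zero_ne_one

theorem ArcBetween.left_mem {J : Set X} {x y : X} (h : ArcBetween J x y) : x ∈ J := by
  obtain ⟨γ, hγ, rfl, rfl, rfl⟩ := h
  exact mem_range_self _

theorem ArcBetween.right_mem {J : Set X} {x y : X} (h : ArcBetween J x y) : y ∈ J :=
  h.symm.left_mem

theorem ArcBetween.isClosed [T2Space X] {J : Set X} {x y : X} (h : ArcBetween J x y) :
    IsClosed J := by
  obtain ⟨γ, hγ, rfl, rfl, rfl⟩ := h
  exact (isCompact_range γ.continuous).isClosed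

theorem arcBetween_image_Icc {γ : C(unitInterval, X)} (hγ : Function.Injective γ)
    {s t : unitInterval} (hst : s < t) : ArcBetween (γ '' Icc s t) (γ s) (γ t) := by
  have hst' : (0 : ℝ) < t - s := sub_pos.2 hst
  have hmem : ∀ u : unitInterval, (s + u * (t - s) : ℝ) ∈ unitInterval := fun u =>
    ⟨by nlinarith [s.2.1, u.2.1], by nlinarith [t.2.2, u.2.2]⟩
  let f : C(unitInterval, unitInterval) := ⟨fun u => ⟨s + u * (t - s), hmem u⟩, by fun_prop⟩
  have hf : Function.Injective f := by
    intro u v h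
    have h1 : (s + u * (t - s) : ℝ) = s + v * (t - s) := congrArg Subtype.val h
    exact Subtype.ext (mul_right_cancel₀ hst'.ne' (add_left_cancel h1))
  have hr : range f = Icc s t := by
    ext v
    constructor
    · rintro ⟨u, rfl⟩
      constructor
      · change (s : ℝ) ≤ s + u * (t - s)
        nlinarith [u.2.1]
      · change (s + u * (t - s) : ℝ) ≤ t
        nlinarith [u.2.2]
    · rintro ⟨h1, h2⟩
      have h1' : (s : ℝ) ≤ v := h1
      have h2' : (v : ℝ) ≤ t := h2
      refine ⟨⟨(v - s) / (t - s), div_nonneg (sub_nonneg.2 h1') hst'.le,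
        (div_le_one hst').2 (by linarith)⟩, Subtype.ext ?_⟩
      change (s + (v - s) / (t - s) * (t - s) : ℝ) = v
      field_simp
      ring
  refine ⟨γ.comp f, hγ.comp hf, ?_, congrArg γ (Subtype.ext ?_), congrArg γ (Subtype.ext ?_)⟩
  · rw [← hr, ← range_comp]
    rfl
  · change (s + 0 * (t - s) : ℝ) = s
    ring
  · change (s + 1 * (t - s) : ℝ) = t
    ring

theorem ArcBetween.exists_subarc {A : Set X} {x y a b : X} (hA : ArcBetween A x y) (ha : a ∈ A)
    (hb : b ∈ A) (hab : a ≠ b) : ∃ S ⊆ A, ArcBetween S a b := by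
  obtain ⟨γ, hγ, rfl, rfl, rfl⟩ := hA
  obtain ⟨s, rfl⟩ := ha
  obtain ⟨t, rfl⟩ := hb
  rcases lt_trichotomy s t with h | rfl | h
  · exact ⟨_, image_subset_range _ _, arcBetween_image_Icc hγ h⟩
  · exact absurd rfl hab
  · exact ⟨_, image_subset_range _ _, (arcBetween_image_Icc hγ h).symm⟩

theorem ArcBetween.exists_initial {A : Set X} {x y : X} (hA : ArcBetween A x y) :
    ∃ B ⊆ A, y ∉ B ∧ ∃ m, ArcBetween B x m := by
  obtain ⟨γ, hγ, rfl, rfl, rfl⟩ := hA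
  let h : unitInterval := ⟨1 / 2, by norm_num, by norm_num⟩
  have h0 : 0 < h := by
    change (0 : ℝ) < 1 / 2
    norm_num
  have h1 : h < 1 := by
    change (1 / 2 : ℝ) < 1
    norm_num
  refine ⟨γ '' Icc 0 h, image_subset_range _ _, ?_, γ h, arcBetween_image_Icc hγ h0⟩
  rw [hγ.mem_set_image]
  exact fun h' => absurd h'.2 (not_le.2 h1)

theorem ArcBetween.exists_split {A : Set X} {x y c : X} (hA : ArcBetween A x y) (hc : c ∈ A)
    (hx : c ≠ x) (hy : c ≠ y) : ∃ A₁ ⊆ A, ∃ A₂ ⊆ A, ArcBetween A₁ c x ∧ ArcBetween A₂ c y ∧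
      A₁ ∩ A₂ = {c} := by
  obtain ⟨γ, hγ, rfl, rfl, rfl⟩ := hA
  obtain ⟨t, rfl⟩ := hc
  have h0 : 0 < t := lt_of_le_of_ne bot_le fun h => hx (congrArg γ h.symm)
  have h1 : t < 1 := lt_of_le_of_ne le_top fun h => hy (congrArg γ h)
  refine ⟨_, image_subset_range _ _, _, image_subset_range _ _,
    (arcBetween_image_Icc hγ h0).symm, arcBetween_image_Icc hγ h1, ?_⟩
  rw [← image_inter hγ, Icc_inter_Icc_eq_singleton h0.le h1.le, image_singleton]

theorem ArcBetween.exists_firstHit {J C : Set X} {z w : X} (hJ : ArcBetween J z w)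
    (hC : IsClosed C) (hz : z ∉ C) (hw : w ∈ C) :
    ∃ c, ∃ Z ⊆ J, ArcBetween Z c z ∧ Z ∩ C = {c} := by
  obtain ⟨γ, hγ, rfl, rfl, rfl⟩ := hJ
  obtain ⟨t, ht, hmin⟩ := (hC.preimage γ.continuous).isCompact.exists_isLeast ⟨1, hw⟩
  have h0 : 0 < t := lt_of_le_of_ne bot_le fun h => hz (by rw [h]; exact ht)
  refine ⟨γ t, _, image_subset_range _ _, (arcBetween_image_Icc hγ h0).symm, ?_⟩
  ext p
  constructor
  · rintro ⟨⟨s, hs, rfl⟩, hsC⟩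
    rw [le_antisymm hs.2 (hmin hsC)]
    rfl
  · rintro rfl
    exact ⟨⟨t, ⟨h0.le, le_rfl⟩, rfl⟩, ht⟩

/-- From `p`, follow the arc back to its last time in `C` and forward to its first. If both ends of
this excursion are ends of `J`, these times are 0 and 1, so the excursion is all of `J`. -/
theorem ArcBetween.exists_excursion {J C : Set X} {x y p : X} (hJ : ArcBetween J x y)
    (hC : IsClosed C) (hx : x ∈ C) (hy : y ∈ C) (hp : p ∈ J) (hpC : p ∉ C) :
    ∃ a b, ∃ E ⊆ J, ArcBetween E a b ∧ E ∩ C = {a, b} ∧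
      (a ∈ ({x, y} : Set X) → b ∈ ({x, y} : Set X) → E = J ∧ ({a, b} : Set X) = {x, y}) := by
  obtain ⟨γ, hγ, rfl, rfl, rfl⟩ := hJ
  obtain ⟨u, rfl⟩ := hp
  have hcl := hC.preimage γ.continuous
  obtain ⟨s, ⟨hsC, hsu⟩, hs⟩ := (hcl.inter isClosed_Iic).isCompact.exists_isGreatest
    (s := γ ⁻¹' C ∩ Iic u) ⟨0, hx, bot_le (a := u)⟩
  obtain ⟨t, ⟨htC, hut⟩, ht⟩ := (hcl.inter isClosed_Ici).isCompact.exists_isLeast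
    (s := γ ⁻¹' C ∩ Ici u) ⟨1, hy, le_top (a := u)⟩
  have hsu' : s < u := lt_of_le_of_ne hsu fun h => hpC (h ▸ hsC)
  have hut' : u < t := lt_of_le_of_ne hut fun h => hpC (h ▸ htC)
  refine ⟨γ s, γ t, _, image_subset_range _ _, arcBetween_image_Icc hγ (hsu'.trans hut'), ?_, ?_⟩
  · ext q
    constructor
    · rintro ⟨⟨v, hv, rfl⟩, hvC⟩
      rcases le_total v u with h | h
      · exact .inl (congrArg γ (le_antisymm (hs ⟨hvC, h⟩) hv.1))
      · exact .inr (congrArg γ (le_antisymm hv.2 (ht ⟨hvC, h⟩)))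
    · rintro (rfl | rfl)
      · exact ⟨⟨s, ⟨le_rfl, (hsu'.trans hut').le⟩, rfl⟩, hsC⟩
      · exact ⟨⟨t, ⟨(hsu'.trans hut').le, le_rfl⟩, rfl⟩, htC⟩
  · intro ha hb
    have hs0 : s = 0 := by
      rcases ha with h | h
      · exact hγ h
      · exact absurd (hγ h) ((hsu'.trans hut').trans_le le_top).ne
    have ht1 : t = 1 := by
      rcases hb with h | h
      · exact absurd (hγ h) (bot_le.trans_lt (hsu'.trans hut')).ne'
      · exact hγ h
    rw [hs0, ht1, ← image_univ]
    refine ⟨congrArg _ (eq_univ_of_forall fun v => ⟨bot_le, le_top⟩), rfl⟩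

end Subarcs

/-! ### Triods and Jordan curves -/

section Curves

variable {X : Type*} [TopologicalSpace X]

theorem arcBetween_range_exp {f : Circle → X} (hf : Continuous f) (hinj : Function.Injective f)
    (z : Circle) {θ : ℝ} (h0 : θ ≠ 0) (hθ : |θ| < 2 * Real.pi) :
    ArcBetween (range fun u : unitInterval => f (z * Circle.exp (u * θ))) (f z)
      (f (z * Circle.exp θ)) := by
  refine ⟨⟨fun u => f (z * Circle.exp (u * θ)), by fun_prop⟩, ?_, rfl, by simp, by simp⟩
  intro u v huv
  obtain ⟨m, hm⟩ := Circle.exp_eq_exp.1 (mul_left_cancel (hinj huv))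
  have h1 : ((u : ℝ) - v) * θ = m * (2 * Real.pi) := by linarith
  have hpi := Real.pi_pos
  have h2 : |(m : ℝ)| < 1 := by
    have : |(m : ℝ)| * (2 * Real.pi) < 1 * (2 * Real.pi) := by
      calc |(m : ℝ)| * (2 * Real.pi) = |(u : ℝ) - v| * |θ| := by
            rw [← abs_mul, h1, abs_mul, abs_of_pos (by positivity : 0 < 2 * Real.pi)]
        _ ≤ 1 * |θ| := by
            gcongr
            rw [abs_le]
            constructor <;> linarith [u.2.1, u.2.2, v.2.1, v.2.2]
        _ < 1 * (2 * Real.pi) := by linarith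
    exact lt_of_mul_lt_mul_right this (by positivity)
  have h3 : m = 0 := by
    rw [← Int.cast_abs] at h2
    exact Int.abs_lt_one_iff.1 (by exact_mod_cast h2)
  rw [h3] at h1
  simp only [Int.cast_zero, zero_mul, mul_eq_zero, h0, or_false] at h1
  exact Subtype.ext (sub_eq_zero.1 h1)

/-- One arc turns by `θ`, the other by `θ - 2π`. At a common point, `u * θ + v * (2π - θ)` is a
multiple of `2π` between 0 and `2π`, so it is one of the two extremes, which are the endpoints. -/
theorem IsJordanCurve.exists_arcBetween {C : Set X} (hC : IsJordanCurve C) {x y : X} (hx : x ∈ C)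
    (hy : y ∈ C) (hxy : x ≠ y) : ∃ A ⊆ C, ∃ B ⊆ C, ArcBetween A x y ∧ ArcBetween B x y ∧
      A ∩ B = {x, y} := by
  obtain ⟨h⟩ := hC
  obtain ⟨z, hz⟩ := h.surjective ⟨x, hx⟩
  obtain ⟨w, hw⟩ := h.surjective ⟨y, hy⟩
  let f : Circle → X := fun z => h z
  have hf : Continuous f := by fun_prop
  have hinj : Function.Injective f := Subtype.val_injective.comp h.injective
  obtain rfl : f z = x := congrArg Subtype.val hz
  obtain rfl : f w = y := congrArg Subtype.val hw
  have hpi := Real.pi_pos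
  obtain ⟨θ, hθ0, hθ1, hθ⟩ : ∃ θ : ℝ, 0 < θ ∧ θ < 2 * Real.pi ∧ z * Circle.exp θ = w := by
    have harg : z * Circle.exp (Complex.arg (w / z : Circle)) = w := by
      rw [Circle.exp_arg, mul_div_cancel]
    have hne : Complex.arg (w / z : Circle) ≠ 0 := by
      intro h
      rw [h, Circle.exp_zero, mul_one] at harg
      exact hxy (congrArg f harg)
    have h1 := Complex.neg_pi_lt_arg (w / z : Circle)
    have h2 := Complex.arg_le_pi (w / z : Circle)
    rcases lt_or_gt_of_ne hne with h | h
    · refine ⟨_ + 2 * Real.pi, by linarith, by linarith, ?_⟩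
      rw [Circle.exp_add, Circle.exp_two_pi, mul_one, harg]
    · exact ⟨_, h, by linarith, harg⟩
  have hθ' : z * Circle.exp (θ - 2 * Real.pi) = w := by
    rw [Circle.exp_sub, Circle.exp_two_pi, div_one, hθ]
  have hA := arcBetween_range_exp hf hinj z hθ0.ne' (by rwa [abs_of_pos hθ0])
  have hB := arcBetween_range_exp hf hinj z (θ := θ - 2 * Real.pi) (by linarith)
    (by rw [abs_lt]; constructor <;> linarith)
  rw [hθ] at hA
  rw [hθ'] at hB
  refine ⟨_, ?_, _, ?_, hA, hB, ?_⟩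
  · rintro _ ⟨u, rfl⟩
    exact (h _).2
  · rintro _ ⟨u, rfl⟩
    exact (h _).2
  · apply Subset.antisymm
    · rintro _ ⟨⟨u, rfl⟩, ⟨v, hv⟩⟩
      obtain ⟨m, hm⟩ := Circle.exp_eq_exp.1 (mul_left_cancel (hinj hv))
      have hu0 := u.2.1
      have hu1 := u.2.2
      have hv0 := v.2.1
      have hv1 := v.2.2
      have hsum : (u : ℝ) * θ + v * (2 * Real.pi - θ) = (-m : ℤ) * (2 * Real.pi) := by
        push_cast
        linarith
      have hlow : 0 ≤ (u : ℝ) * θ := by positivity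
      have hlow' : 0 ≤ (v : ℝ) * (2 * Real.pi - θ) := mul_nonneg hv0 (by linarith)
      have hup : (u : ℝ) * θ ≤ θ := mul_le_of_le_one_left hθ0.le hu1
      have hup' : (v : ℝ) * (2 * Real.pi - θ) ≤ 2 * Real.pi - θ :=
        mul_le_of_le_one_left (by linarith) hv1
      have hk0 : (0 : ℝ) ≤ (-m : ℤ) := by
        by_contra! h
        nlinarith
      have hk1 : ((-m : ℤ) : ℝ) ≤ 1 := by
        by_contra! h
        nlinarith
      have hk : -m = 0 ∨ -m = 1 := by
        have h1 : (0 : ℤ) ≤ -m := by exact_mod_cast hk0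
        have h2 : -m ≤ (1 : ℤ) := by exact_mod_cast hk1
        omega
      rcases hk with hk | hk <;> rw [hk] at hsum
      · left
        have : (u : ℝ) * θ = 0 := by
          push_cast at hsum
          linarith
        simp [this]
      · right
        have : (u : ℝ) * θ = θ := by
          push_cast at hsum
          linarith
        simp [this, hθ]
    · rintro _ (rfl | rfl)
      · exact ⟨hA.left_mem, hB.left_mem⟩
      · exact ⟨hA.right_mem, hB.right_mem⟩

variable [T2Space X]

theorem ArcBetween.exists_isTriod {A B C : Set X} {c x y z : X} (hA : ArcBetween A c x)
    (hB : ArcBetween B c y) (hC : ArcBetween C c z) (hAB : A ∩ B ⊆ {c}) (hAC : A ∩ C ⊆ {c})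
    (hBC : B ∩ C ⊆ {c}) : IsTriod (A ∪ B ∪ C) := by
  have key : ∀ P Q : Set X, c ∈ P → c ∈ Q → P ∩ Q ⊆ {c} → P ∩ Q = {c} := fun P Q hP hQ h =>
    h.antisymm (singleton_subset_iff.2 ⟨hP, hQ⟩)
  have e1 := key A B hA.left_mem hB.left_mem hAB
  have e2 := key A C hA.left_mem hC.left_mem hAC
  have e3 := key B C hB.left_mem hC.left_mem hBC
  refine ⟨![A, B, C], c, ?_, ?_, ?_⟩
  · intro i
    fin_cases i
    · exact ⟨hA.isArc, by simp [hA.endpoints_eq]⟩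
    · exact ⟨hB.isArc, by simp [hB.endpoints_eq]⟩
    · exact ⟨hC.isArc, by simp [hC.endpoints_eq]⟩
  · intro i j hij
    fin_cases i <;> fin_cases j <;> simp_all [inter_comm]
  · ext p
    simp [Fin.exists_fin_succ, or_assoc]

theorem isJordanCurve_range {f : Circle → X} (hf : Continuous f) (hinj : Function.Injective f) :
    IsJordanCurve (range f) :=
  ⟨(hf.isClosedEmbedding hinj).isEmbedding.toHomeomorph⟩

theorem circle_re_sq_add_im_sq (z : Circle) : (z : ℂ).re ^ 2 + (z : ℂ).im ^ 2 = 1 := by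
  have := Circle.normSq_coe z
  rw [Complex.normSq_apply] at this
  linarith

/-- The circle is projected to the interval by `(1 - re z) / 2`; the upper half is sent along one
arc and the lower half along the other. -/
theorem ArcBetween.isJordanCurve_union {A B : Set X} {x y : X} (hA : ArcBetween A x y)
    (hB : ArcBetween B x y) (hAB : A ∩ B = {x, y}) : IsJordanCurve (A ∪ B) := by
  obtain ⟨γ, hγ, rfl, rfl, rfl⟩ := hA
  obtain ⟨δ, hδ, rfl, h0, h1⟩ := hB
  have hmem : ∀ z : Circle, (1 - (z : ℂ).re) / 2 ∈ unitInterval := fun z => by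
    have := circle_re_sq_add_im_sq z
    constructor <;> nlinarith [sq_nonneg (z : ℂ).im]
  let r : Circle → unitInterval := fun z => ⟨(1 - (z : ℂ).re) / 2, hmem z⟩
  have hr : Continuous r := by
    refine Continuous.subtype_mk ?_ _
    have : Continuous fun z : Circle => (z : ℂ).re :=
      Complex.continuous_re.comp continuous_subtype_val
    fun_prop
  have hre : ∀ {z w : Circle}, r z = r w → (z : ℂ).re = (w : ℂ).re := fun {z w} h => by
    have : (1 - (z : ℂ).re) / 2 = (1 - (w : ℂ).re) / 2 := congrArg Subtype.val h
    linarith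
  have hr01 : ∀ z : Circle, (z : ℂ).im = 0 ↔ r z = 0 ∨ r z = 1 := by
    intro z
    have := circle_re_sq_add_im_sq z
    constructor
    · intro h
      rw [h] at this
      have h2 : ((z : ℂ).re - 1) * ((z : ℂ).re + 1) = 0 := by linarith
      rcases mul_eq_zero.1 h2 with h3 | h3
      · exact .inl (Subtype.ext (show (1 - (z : ℂ).re) / 2 = 0 by linarith))
      · exact .inr (Subtype.ext (show (1 - (z : ℂ).re) / 2 = 1 by linarith))
    · rintro (h | h)
      · have h2 : (1 - (z : ℂ).re) / 2 = 0 := congrArg Subtype.val h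
        have h3 : (z : ℂ).re = 1 := by linarith
        rw [h3] at this
        nlinarith
      · have h2 : (1 - (z : ℂ).re) / 2 = 1 := congrArg Subtype.val h
        have h3 : (z : ℂ).re = -1 := by linarith
        rw [h3] at this
        nlinarith
  have hcross : ∀ s t, γ s = δ t → s = t ∧ (s = 0 ∨ s = 1) := by
    intro s t h
    have : γ s ∈ ({γ 0, γ 1} : Set X) := hAB ▸ ⟨mem_range_self s, h ▸ mem_range_self t⟩
    rcases this with h' | h'
    · have hs := hγ h'
      exact ⟨hs.trans (hδ (h0.trans (h'.symm.trans h))), .inl hs⟩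
    · have hs := hγ h'
      exact ⟨hs.trans (hδ (h1.trans (h'.symm.trans h))), .inr hs⟩
  let f : Circle → X := fun z => if 0 ≤ (z : ℂ).im then γ (r z) else δ (r z)
  have hf : Continuous f := by
    refine Continuous.if_le (γ.continuous.comp hr) (δ.continuous.comp hr) continuous_const
      (Complex.continuous_im.comp continuous_subtype_val) fun z hz => ?_
    rcases (hr01 z).1 hz.symm with h | h
    · simp [h, h0]
    · simp [h, h1]
  have hfinj : Function.Injective f := by
    intro z w hzw
    have hz := circle_re_sq_add_im_sq z
    have hw := circle_re_sq_add_im_sq w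
    have hcases : (z : ℂ).re = (w : ℂ).re ∧ 0 ≤ (z : ℂ).im * (w : ℂ).im := by
      by_cases h1 : 0 ≤ (z : ℂ).im <;> by_cases h2 : 0 ≤ (w : ℂ).im <;>
        simp only [f, h1, h2, if_true, if_false] at hzw
      · exact ⟨hre (hγ hzw), mul_nonneg h1 h2⟩
      · obtain ⟨h3, h4⟩ := hcross _ _ hzw
        rw [h3, ← hr01] at h4
        exact ⟨hre h3, by simp [h4]⟩
      · obtain ⟨h3, h4⟩ := hcross _ _ hzw.symm
        rw [h3, ← hr01] at h4
        exact ⟨(hre h3).symm, by simp [h4]⟩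
      · exact ⟨hre (hδ hzw), mul_nonneg_of_nonpos_of_nonpos (not_le.1 h1).le (not_le.1 h2).le⟩
    obtain ⟨hre', him⟩ := hcases
    refine Subtype.ext (Complex.ext hre' ?_)
    rw [hre'] at hz
    have : ((z : ℂ).im - (w : ℂ).im) * ((z : ℂ).im + (w : ℂ).im) = 0 := by linarith
    rcases mul_eq_zero.1 this with h | h
    · exact sub_eq_zero.1 h
    · have h' : (w : ℂ).im = -(z : ℂ).im := by linarith
      rw [h'] at him ⊢
      nlinarith
  convert isJordanCurve_range hf hfinj using 1
  have hex : ∀ t : unitInterval, ∀ ε : ℝ, ε ^ 2 = 1 →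
      ∃ z : Circle, r z = t ∧ (z : ℂ).im = ε * √(1 - (1 - 2 * (t : ℝ)) ^ 2) := by
    intro t ε hε
    have hnn : (0 : ℝ) ≤ 1 - (1 - 2 * (t : ℝ)) ^ 2 := by nlinarith [t.2.1, t.2.2]
    refine ⟨⟨⟨1 - 2 * t, ε * √(1 - (1 - 2 * (t : ℝ)) ^ 2)⟩, ?_⟩, Subtype.ext ?_, rfl⟩
    · refine mem_sphere_zero_iff_norm.2 ?_
      rw [← pow_eq_one_iff_of_nonneg (norm_nonneg _) two_ne_zero, Complex.sq_norm,
        Complex.normSq_mk, mul_mul_mul_comm, Real.mul_self_sqrt hnn, ← sq, ← sq, hε]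
      ring
    · change (1 - (1 - 2 * (t : ℝ))) / 2 = t
      ring
  ext p
  constructor
  · rintro (⟨t, rfl⟩ | ⟨t, rfl⟩)
    · obtain ⟨z, rfl, hz⟩ := hex t 1 (by norm_num)
      refine ⟨z, if_pos ?_⟩
      rw [hz]
      positivity
    · obtain ⟨z, rfl, hz⟩ := hex t (-1) (by norm_num)
      by_cases him : 0 ≤ (z : ℂ).im
      · refine ⟨z, ?_⟩
        have hsqrt := Real.sqrt_nonneg (1 - (1 - 2 * (r z : ℝ)) ^ 2)
        have him0 : (z : ℂ).im = 0 := le_antisymm (by linarith) him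
        simp only [f, him, if_true]
        rcases (hr01 z).1 him0 with h | h
        · rw [h, h0]
        · rw [h, h1]
      · exact ⟨z, if_neg him⟩
  · rintro ⟨z, rfl⟩
    by_cases him : 0 ≤ (z : ℂ).im
    · exact .inl ⟨r z, (if_pos him).symm⟩
    · exact .inr ⟨r z, (if_neg him).symm⟩

/-- An excursion of one arc away from the other is closed up by the subarc of the other between its
ends. -/
theorem ArcBetween.exists_isJordanCurve {J K : Set X} {x y : X} (hJ : ArcBetween J x y)
    (hK : ArcBetween K x y) (hne : J ≠ K) : ∃ C ⊆ J ∪ K, IsJordanCurve C := by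
  wlog h : ∃ p ∈ J, p ∉ K generalizing J K
  · have h' : ∃ p ∈ K, p ∉ J := by
      by_contra! h'
      push Not at h
      exact hne (Subset.antisymm h h')
    rw [union_comm]
    exact this hK hJ hne.symm h'
  obtain ⟨p, hpJ, hpK⟩ := h
  obtain ⟨a, b, E, hEJ, hE, hEK, -⟩ :=
    hJ.exists_excursion hK.isClosed hK.left_mem hK.right_mem hpJ hpK
  have hab : {a, b} ⊆ K := hEK ▸ inter_subset_right
  obtain ⟨S, hSK, hS⟩ := hK.exists_subarc (hab (.inl rfl)) (hab (.inr rfl)) hE.ne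
  refine ⟨E ∪ S, union_subset_union hEJ hSK, hE.isJordanCurve_union hS ?_⟩
  refine ((inter_subset_inter_right _ hSK).trans hEK.subset).antisymm ?_
  rintro _ (rfl | rfl)
  · exact ⟨hE.left_mem, hS.left_mem⟩
  · exact ⟨hE.right_mem, hS.right_mem⟩

/-- An arc attached at an interior point of `A` would form a triod with the two pieces of `A` at
that point. -/
theorem ArcBetween.mem_endpoints_of_no_triod {F A E : Set X} (hF : ∀ T ⊆ F, ¬ IsTriod T)
    {x y c z : X} (hA : ArcBetween A x y) (hAF : A ⊆ F) (hE : ArcBetween E c z) (hEF : E ⊆ F)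
    (hAE : A ∩ E = {c}) : c ∈ ({x, y} : Set X) := by
  by_contra h
  simp only [mem_insert_iff, mem_singleton_iff, not_or] at h
  have hc : c ∈ A := (hAE.superset rfl).1
  obtain ⟨A₁, h₁, A₂, h₂, hA₁, hA₂, h12⟩ := hA.exists_split hc h.1 h.2
  exact hF (A₁ ∪ A₂ ∪ E) (union_subset (union_subset (h₁.trans hAF) (h₂.trans hAF)) hEF)
    (hA₁.exists_isTriod hA₂ hE h12.subset ((inter_subset_inter_left _ h₁).trans hAE.subset)
    ((inter_subset_inter_left _ h₂).trans hAE.subset))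

/-- An excursion of `J` away from `K` can be attached only at endpoints of `K`, so it is the whole
of `J`. -/
theorem ArcBetween.inter_eq_of_no_triod {F J K : Set X} (hF : ∀ T ⊆ F, ¬ IsTriod T) {x y : X}
    (hJ : ArcBetween J x y) (hK : ArcBetween K x y) (hJF : J ⊆ F) (hKF : K ⊆ F) (hne : J ≠ K) :
    J ∩ K = {x, y} := by
  wlog h : ∃ p ∈ J, p ∉ K generalizing J K
  · have h' : ∃ p ∈ K, p ∉ J := by
      by_contra! h'
      push Not at h
      exact hne (Subset.antisymm h h')
    rw [inter_comm]
    exact this hK hJ hKF hJF hne.symm h'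
  obtain ⟨p, hpJ, hpK⟩ := h
  obtain ⟨a, b, E, hEJ, hE, hEK, hend⟩ :=
    hJ.exists_excursion hK.isClosed hK.left_mem hK.right_mem hpJ hpK
  have key : ∀ {a b : X}, ArcBetween E a b → E ∩ K = {a, b} → a ∈ ({x, y} : Set X) := by
    intro a b hE hEK
    -- Cutting off the far end `b` leaves an arc that meets `K` only at `a`.
    obtain ⟨E', hE'E, hb, m, hE'⟩ := hE.exists_initial
    refine hK.mem_endpoints_of_no_triod hF hKF hE' (hE'E.trans (hEJ.trans hJF)) ?_
    apply Subset.antisymm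
    · rintro q ⟨hqK, hqE⟩
      rcases (hEK.subset ⟨hE'E hqE, hqK⟩ : q ∈ ({a, b} : Set X)) with rfl | rfl
      · rfl
      · exact absurd hqE hb
    · rintro _ rfl
      exact ⟨(hEK.superset (.inl rfl)).2, hE'.left_mem⟩
  obtain ⟨h1, h2⟩ := hend (key hE hEK) (key hE.symm (hEK.trans (pair_comm _ _)))
  rw [← h1, hEK, h2]

/-- Three different arcs would meet pairwise only at `x` and `y`; shortened before `y`, they form a
triod at `x`. -/
theorem ArcBetween.eq_or_eq_of_no_triod {F J K L : Set X} (hF : ∀ T ⊆ F, ¬ IsTriod T) {x y : X}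
    (hJ : ArcBetween J x y) (hK : ArcBetween K x y) (hL : ArcBetween L x y) (hJF : J ⊆ F)
    (hKF : K ⊆ F) (hLF : L ⊆ F) (hJK : J ≠ K) : L = J ∨ L = K := by
  by_contra! h
  obtain ⟨J', hJ', hyJ, _, haJ⟩ := hJ.exists_initial
  obtain ⟨K', hK', hyK, _, haK⟩ := hK.exists_initial
  obtain ⟨L', hL', hyL, _, haL⟩ := hL.exists_initial
  have key : ∀ {P Q P' Q' : Set X}, P ∩ Q = {x, y} → P' ⊆ P → Q' ⊆ Q → y ∉ P' →
      P' ∩ Q' ⊆ {x} := by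
    rintro P Q P' Q' h hP hQ hy q ⟨hqP, hqQ⟩
    rcases (h.subset ⟨hP hqP, hQ hqQ⟩ : q ∈ ({x, y} : Set X)) with rfl | rfl
    · rfl
    · exact absurd hqP hy
  refine hF (J' ∪ K' ∪ L') (union_subset (union_subset (hJ'.trans hJF) (hK'.trans hKF))
    (hL'.trans hLF)) (haJ.exists_isTriod haK haL ?_ ?_ ?_)
  · exact key (hJ.inter_eq_of_no_triod hF hK hJF hKF hJK) hJ' hK' hyJ
  · exact key (hJ.inter_eq_of_no_triod hF hL hJF hLF h.1.symm) hJ' hL' hyJ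
  · exact key (hK.inter_eq_of_no_triod hF hL hKF hLF h.2.symm) hK' hL' hyK

theorem IsJordanCurve.isClosed {C : Set X} (hC : IsJordanCurve C) : IsClosed C := by
  obtain ⟨h⟩ := hC
  have : C = range fun z => (h z : X) := by
    ext x
    exact ⟨fun hx => ⟨h.symm ⟨x, hx⟩, by simp⟩, fun ⟨z, hz⟩ => hz ▸ (h z).2⟩
  rw [this]
  exact (isCompact_range (by fun_prop)).isClosed

theorem IsArcConnected.exists_arcBetween {F : Set X} (hF : IsArcConnected F) {x y : X} (hx : x ∈ F)
    (hy : y ∈ F) (hxy : x ≠ y) : ∃ J ⊆ F, ArcBetween J x y := by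
  obtain ⟨J, hJ, hJF, he⟩ := hF x hx y hy
  rcases isPDArc_and_endpoints_iff.1 ⟨hJ, he⟩ with h | ⟨h, -⟩
  · exact ⟨J, hJF, h⟩
  · exact absurd h hxy

/-- In an arc-connected set which contains no triod, a Jordan curve is the whole set. -/
theorem IsArcConnected.subset_of_isJordanCurve {F C : Set X} (hF : IsArcConnected F)
    (hT : ∀ T ⊆ F, ¬ IsTriod T) (hC : IsJordanCurve C) (hCF : C ⊆ F) : F ⊆ C := by
  intro z hz
  by_contra hzC
  obtain ⟨h⟩ := id hC
  obtain ⟨J, hJF, hJ⟩ := hF.exists_arcBetween hz (hCF (h 1).2) (fun h' => hzC (h' ▸ (h 1).2))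
  -- An arc from `z` to the curve, stopped at its first hit `c`, forms a triod with short arcs of
  -- the curve on the two sides of `c`.
  obtain ⟨c, Z, hZJ, hZ, hZC⟩ := hJ.exists_firstHit hC.isClosed hzC (h 1).2
  have hc : c ∈ C := (hZC.superset rfl).2
  obtain ⟨w, hw⟩ := h.surjective ⟨c, hc⟩
  obtain ⟨c', hc', hne⟩ : ∃ c' ∈ C, c ≠ c' := by
    refine ⟨h (-w), (h (-w)).2, fun h' => Circle.neg_ne_self w (h.injective (Subtype.ext ?_))⟩
    rw [← h', hw]
  obtain ⟨A, hAC, B, hBC, hA, hB, hAB⟩ := hC.exists_arcBetween hc hc' hne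
  obtain ⟨A', hA'A, hcA, _, hA'⟩ := hA.exists_initial
  obtain ⟨B', hB'B, hcB, _, hB'⟩ := hB.exists_initial
  refine hT (A' ∪ B' ∪ Z) (union_subset (union_subset ((hA'A.trans hAC).trans hCF)
    ((hB'B.trans hBC).trans hCF)) (hZJ.trans hJF)) (hA'.exists_isTriod hB' hZ ?_ ?_ ?_)
  · rintro q ⟨hqA, hqB⟩
    rcases (hAB.subset ⟨hA'A hqA, hB'B hqB⟩ : q ∈ ({c, c'} : Set X)) with rfl | rfl
    · rfl
    · exact absurd hqA hcA
  · exact fun q ⟨hqA, hqZ⟩ => hZC.subset ⟨hqZ, hAC (hA'A hqA)⟩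
  · exact fun q ⟨hqB, hqZ⟩ => hZC.subset ⟨hqZ, hBC (hB'B hqB)⟩

end Curves

end ArcConnected

namespace ArcConnected

/-! ### Measurability of sets of paths -/

section PathSpace

variable {X : Type*} [TopologicalSpace X]

theorem isClosed_exists_of_compactSpace {Z Y : Type*} [TopologicalSpace Z] [TopologicalSpace Y]
    [CompactSpace Y] {S : Set (Z × Y)} (hS : IsClosed S) : IsClosed {z | ∃ y, (z, y) ∈ S} := by
  convert isClosedMap_fst_of_compactSpace S hS using 1
  ext z
  simp

/-- Coincidence somewhere on a compact piece is a closed condition, by projection along a compact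
space. Conditions on a noncompact set of parameters follow by exhausting it with countably many
pieces `K n`. -/
theorem measurableSet_forall_ne [T2Space X] {Z : Type*} [TopologicalSpace Z] [MeasurableSpace Z]
    [OpensMeasurableSpace Z] {Y : Type*} [TopologicalSpace Y] [CompactSpace Y] {K : ℕ → Set Y}
    (hK : ∀ n, IsClosed (K n)) {u v : Z × Y → X} (hu : Continuous u) (hv : Continuous v) :
    MeasurableSet {z | ∀ n, ∀ y ∈ K n, u (z, y) ≠ v (z, y)} := by
  rw [ofPred_forall]
  refine MeasurableSet.iInter fun n => ?_
  have h : IsClosed {z | ∃ y, (z, y) ∈ {p : Z × Y | p.2 ∈ K n ∧ u p = v p}} :=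
    isClosed_exists_of_compactSpace (((hK n).preimage continuous_snd).inter (isClosed_eq hu hv))
  convert h.measurableSet.compl using 1
  ext z
  simp

theorem isPolish_pathSpace [PolishSpace X] : PolishSpace C(unitInterval, X) := by
  let := upgradeIsCompletelyMetrizable X
  infer_instance

variable [PolishSpace X]

theorem measurableSet_mem_closeds [MeasurableSpace X] [BorelSpace X] :
    MeasurableSet {q : Closeds X × X | q.2 ∈ q.1} := by
  obtain ⟨U, hU⟩ := exists_seq_basis X
  have : {q : Closeds X × X | q.2 ∈ q.1}ᶜ =
      ⋃ n, {F : Closeds X | ((F : Set X) ∩ U n).Nonempty}ᶜ ×ˢ U n := by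
    ext ⟨F, x⟩
    simp only [mem_compl_iff, mem_ofPred, mem_iUnion, mem_prod]
    constructor
    · intro h
      obtain ⟨_, ⟨n, rfl⟩, hn, hnF⟩ := hU.exists_subset_of_mem_open
        (show x ∈ (F : Set X)ᶜ from h) F.isClosed.isOpen_compl
      exact ⟨n, fun ⟨x, hxF, hxn⟩ => hnF hxn hxF, hn⟩
    · rintro ⟨n, hn, hxn⟩ h
      exact hn ⟨x, h, hxn⟩
  rw [← MeasurableSet.compl_iff, this]
  exact MeasurableSet.iUnion fun n => MeasurableSet.prod
    (measurableSet_hits (hU.isOpen (mem_range_self n))).compl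
    (hU.isOpen (mem_range_self n)).measurableSet

variable [MeasurableSpace C(unitInterval, X)] [BorelSpace C(unitInterval, X)]

theorem measurableSet_injective :
    MeasurableSet {γ : C(unitInterval, X) | Function.Injective γ} := by
  have := measurableSet_forall_ne (X := X) (Z := C(unitInterval, X))
    -- These sets exhaust the complement of the diagonal.
    (K := fun n => {p : unitInterval × unitInterval | (1 / (n + 1) : ℝ) ≤ dist p.1 p.2})
    (fun n => isClosed_le continuous_const (continuous_fst.dist continuous_snd))
    (u := fun q => q.1 q.2.1) (v := fun q => q.1 q.2.2) (by fun_prop) (by fun_prop)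
  convert this using 1
  ext γ
  constructor
  · intro hγ n p hp h
    have h0 : p.1 = p.2 := hγ h
    have hp' : (1 / (n + 1) : ℝ) ≤ dist p.1 p.2 := hp
    rw [h0, dist_self] at hp'
    exact absurd hp' (not_le.2 (by positivity))
  · intro h s t hst
    by_contra hne
    obtain ⟨n, hn⟩ := exists_nat_one_div_lt (dist_pos.2 hne)
    exact h n (s, t) hn.le hst

theorem measurableSet_meet_only_at_zero :
    MeasurableSet {p : C(unitInterval, X) × C(unitInterval, X) |
      ∀ s t, p.1 s = p.2 t → s = 0 ∧ t = 0} := by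
  have := isPolish_pathSpace (X := X)
  have := measurableSet_forall_ne (X := X) (Z := C(unitInterval, X) × C(unitInterval, X))
    -- These sets exhaust the complement of the point `(0, 0)`.
    (K := fun n => {p : unitInterval × unitInterval | (1 / (n + 1) : ℝ) ≤ dist p 0})
    (fun n => isClosed_le continuous_const (continuous_id.dist continuous_const))
    (u := fun q => q.1.1 q.2.1) (v := fun q => q.1.2 q.2.2) (by fun_prop) (by fun_prop)
  convert this using 1
  ext ⟨γ, δ⟩
  constructor
  · intro h n p hp hpq
    have h0 : p = 0 := Prod.ext (h _ _ hpq).1 (h _ _ hpq).2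
    have hp' : (1 / (n + 1) : ℝ) ≤ dist p 0 := hp
    rw [h0, dist_self] at hp'
    exact absurd hp' (not_le.2 (by positivity))
  · intro h s t hst
    by_contra hne
    have hne' : (s, t) ≠ 0 := fun h' => hne ⟨congrArg Prod.fst h', congrArg Prod.snd h'⟩
    obtain ⟨n, hn⟩ := exists_nat_one_div_lt (dist_pos.2 hne')
    exact h n (s, t) hn.le hst

/-- A path leaves `F` exactly when it visits some basic open set that `F` misses. -/
theorem measurableSet_range_subset :
    MeasurableSet {q : Closeds X × C(unitInterval, X) | range q.2 ⊆ (q.1 : Set X)} := by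
  obtain ⟨U, hU⟩ := exists_seq_basis X
  have : {q : Closeds X × C(unitInterval, X) | range q.2 ⊆ (q.1 : Set X)}ᶜ =
      ⋃ n, {F : Closeds X | ((F : Set X) ∩ U n).Nonempty}ᶜ ×ˢ
        (⋃ t : unitInterval, {γ : C(unitInterval, X) | γ t ∈ U n}) := by
    ext ⟨F, γ⟩
    simp only [mem_compl_iff, mem_ofPred, mem_iUnion, mem_prod]
    constructor
    · intro h
      obtain ⟨_, ⟨t, rfl⟩, ht⟩ := not_subset.1 h
      obtain ⟨_, ⟨n, rfl⟩, hn, hnF⟩ := hU.exists_subset_of_mem_open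
        (show γ t ∈ (F : Set X)ᶜ from ht) F.isClosed.isOpen_compl
      exact ⟨n, fun ⟨x, hxF, hxn⟩ => hnF hxn hxF, t, hn⟩
    · rintro ⟨n, hn, t, ht⟩ h
      exact hn ⟨γ t, h (mem_range_self t), ht⟩
  rw [← MeasurableSet.compl_iff, this]
  refine MeasurableSet.iUnion fun n => MeasurableSet.prod
    (measurableSet_hits (hU.isOpen (mem_range_self n))).compl (IsOpen.measurableSet ?_)
  exact isOpen_iUnion fun t => (hU.isOpen (mem_range_self n)).preimage (by fun_prop)

theorem measurableSet_canonPaths [MeasurableSpace X] [BorelSpace X] {g : ℕ → C(X, ℝ)}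
    (hg : IsSeparatingSeq g) :
    MeasurableSet {q : (Closeds X × X × X) × C(unitInterval, X) |
      q.2 ∈ canonPaths g (q.1.1 : Set X) q.1.2.1 q.1.2.2} := by
  have hconst : IsClosed {γ : C(unitInterval, X) | ∀ s t, γ s = γ t} := by
    simp only [ofPred_forall]
    exact isClosed_iInter fun s => isClosed_iInter fun t => isClosed_eq (by fun_prop) (by fun_prop)
  have heval : ∀ t : unitInterval, Measurable fun q : (Closeds X × X × X) × C(unitInterval, X) =>
      q.2 t := fun t => (show Continuous fun γ : C(unitInterval, X) => γ t by
        fun_prop).measurable.comp measurable_snd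
  have hrange := (show Measurable fun q : (Closeds X × X × X) × C(unitInterval, X) =>
    (q.1.1, q.2) by fun_prop) measurableSet_range_subset
  have hsnd : Measurable fun q : (Closeds X × X × X) × C(unitInterval, X) => q.2 := measurable_snd
  have hshape := hsnd ((measurableSet_injective (X := X)).union hconst.measurableSet)
  have hcanon := hsnd (isClosed_isCanonical hg).measurableSet
  exact hshape.inter (hcanon.inter ((measurableSet_eq_fun (heval 0) (by fun_prop)).inter
    ((measurableSet_eq_fun (heval 1) (by fun_prop)).inter hrange)))

/-- The range of a path as a compact set. -/
def rangeCompacts {X : Type*} [TopologicalSpace X] (γ : C(unitInterval, X)) : Compacts X :=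
  ⟨range γ, isCompact_range γ.continuous⟩

theorem continuous_rangeCompacts {X : Type*} [TopologicalSpace X] :
    Continuous (rangeCompacts : C(unitInterval, X) → Compacts X) := by
  refine continuous_induced_rng.2 (continuous_generateFrom_iff.2 ?_)
  rintro _ (⟨U, hU, rfl⟩ | ⟨U, hU, rfl⟩)
  · convert ContinuousMap.isOpen_setOfPred_mapsTo (X := unitInterval) isCompact_univ hU using 1
    ext γ
    change range γ ⊆ U ↔ _
    rw [range_subset_iff]
    simp [MapsTo]
  · have : (((↑) : Compacts X → Set X) ∘ rangeCompacts) ⁻¹' {s | (s ∩ U).Nonempty} =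
        ⋃ t : unitInterval, {γ : C(unitInterval, X) | γ t ∈ U} := by
      ext γ
      simp only [mem_iUnion]
      exact ⟨fun ⟨_, ⟨t, rfl⟩, ht⟩ => ⟨t, ht⟩, fun ⟨t, ht⟩ => ⟨_, ⟨t, rfl⟩, ht⟩⟩
    rw [this]
    exact isOpen_iUnion fun t => hU.preimage (by fun_prop)

end PathSpace

/-! ### Characterizations of the families of closed sets -/

section Families

variable {X : Type*} [TopologicalSpace X] {g : ℕ → C(X, ℝ)}

theorem mem_of_mem_canonPaths {F : Set X} {x y : X} {γ : C(unitInterval, X)}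
    (h : γ ∈ canonPaths g F x y) : x ∈ F ∧ y ∈ F := by
  obtain ⟨-, -, rfl, rfl, h⟩ := h
  exact ⟨h (mem_range_self _), h (mem_range_self _)⟩

theorem ArcBetween.not_subset_pair {J : Set X} {x y : X} (h : ArcBetween J x y) :
    ¬ J ⊆ {x, y} := by
  intro hJ
  obtain ⟨γ, hγ, rfl, rfl, rfl⟩ := h
  have hm := hJ (mem_range_self ⟨1 / 2, by norm_num, by norm_num⟩)
  rcases hm with hm | hm
  · have : (1 / 2 : ℝ) = 0 := congrArg Subtype.val (hγ hm)
    norm_num at this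
  · have : (1 / 2 : ℝ) = 1 := congrArg Subtype.val (hγ hm)
    norm_num at this

theorem IsTriod.nonempty {T : Set X} (hT : IsTriod T) : T.Nonempty := by
  obtain ⟨J, c, -, h, rfl⟩ := hT
  have : c ∈ J 0 ∩ J 1 := h 0 1 (by decide) ▸ rfl
  exact ⟨c, mem_iUnion.2 ⟨0, this.1⟩⟩

theorem IsAtriodic.mono {F G : Set X} (hFG : F ⊆ G) (hG : IsAtriodic G) : IsAtriodic F := by
  have hmono : ∀ x, arcComponent F x ⊆ arcComponent G x :=
    fun x y ⟨J, hJ, hJF, he⟩ => ⟨J, hJ, hJF.trans hFG, he⟩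
  refine eq_empty_of_forall_notMem fun z hz => ?_
  obtain ⟨x, ⟨hx, T, hT, hTx⟩, -⟩ := mem_iUnion₂.1 hz
  obtain ⟨y, hy⟩ := hT.nonempty
  have : y ∈ triodicPart G :=
    mem_iUnion₂.2 ⟨x, ⟨hFG hx, T, hT, hTx.trans (hmono x)⟩, hmono x (hTx hy)⟩
  rw [hG] at this
  exact this

variable [T2Space X]

theorem mem_arcRel_iff (hg : IsSeparatingSeq g) {F : Set X} {p : X × X} :
    p ∈ arcRel F ↔ (canonPaths g F p.1 p.2).Nonempty := by
  constructor
  · rintro ⟨J, hJ, hJF, he⟩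
    obtain ⟨γ, hγ, -⟩ := exists_mem_canonPaths hg hJF hJ he
    exact ⟨γ, hγ⟩
  · rintro ⟨γ, hγ⟩
    have := isPDArc_range_of_mem_canonPaths hγ
    exact ⟨range γ, this.1, hγ.2.2.2.2, this.2⟩

theorem arcBetween_of_mem_canonPaths {F : Set X} {x y : X} {γ : C(unitInterval, X)}
    (h : γ ∈ canonPaths g F x y) (hxy : x ≠ y) : ArcBetween (range γ) x y := by
  rcases isPDArc_and_endpoints_iff.1 (isPDArc_range_of_mem_canonPaths h) with h' | ⟨h', -⟩
  · exact h'
  · exact absurd h' hxy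

theorem ArcBetween.exists_mem_canonPaths (hg : IsSeparatingSeq g) {F J : Set X} {x y : X}
    (hJ : ArcBetween J x y) (hJF : J ⊆ F) : ∃ γ ∈ canonPaths g F x y, range γ = J :=
  ArcConnected.exists_mem_canonPaths hg hJF (.inl hJ.isArc) hJ.endpoints_eq

theorem existsUnique_canonPaths_self (hg : IsSeparatingSeq g) {F : Set X} {x : X} (hx : x ∈ F) :
    ∃! γ, γ ∈ canonPaths g F x x := by
  obtain ⟨γ, hγ, hr⟩ := exists_mem_canonPaths hg (singleton_subset_iff.2 hx) (x := x) (y := x)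
    (.inr ⟨x, rfl⟩) (by simp [endpoints_singleton])
  refine ⟨γ, hγ, fun δ hδ => canonPaths_eq_of_range_eq hg hδ hγ ?_⟩
  rcases isPDArc_and_endpoints_iff.1 (isPDArc_range_of_mem_canonPaths hδ) with h | ⟨-, h⟩
  · exact absurd rfl h.ne
  · rw [h, hr]

/-- Any two points of `F` are joined by a unique canonical path in `F`. -/
def IsUniquelyJoined (g : ℕ → C(X, ℝ)) (F : Set X) : Prop :=
  ∀ x ∈ F, ∀ y ∈ F, ∃! γ, γ ∈ canonPaths g F x y

/-- Any two distinct points of `F` are joined by exactly two canonical paths in `F`. -/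
def IsDoublyJoined (g : ℕ → C(X, ℝ)) (ι : C(unitInterval, X) → ℝ) (F : Set X) : Prop :=
  ∀ x ∈ F, ∀ y ∈ F, x ≠ y → ∃! p : C(unitInterval, X) × C(unitInterval, X),
    p.1 ∈ canonPaths g F x y ∧ p.2 ∈ canonPaths g F x y ∧ ι p.1 < ι p.2

theorem IsUniquelyJoined.isArcConnected (hg : IsSeparatingSeq g) {F : Set X}
    (h : IsUniquelyJoined g F) : IsArcConnected F :=
  fun x hx y hy => (mem_arcRel_iff hg).2 (h x hx y hy).exists

theorem IsDoublyJoined.isArcConnected (hg : IsSeparatingSeq g) {ι : C(unitInterval, X) → ℝ}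
    {F : Set X} (h : IsDoublyJoined g ι F) : IsArcConnected F := by
  intro x hx y hy
  rw [mem_arcRel_iff hg]
  by_cases hxy : x = y
  · subst hxy
    exact (existsUnique_canonPaths_self hg hx).exists
  · obtain ⟨p, hp, -⟩ := h x hx y hy hxy
    exact ⟨p.1, hp.1⟩

theorem exists_isJordanCurve_of_canonPaths_ne (hg : IsSeparatingSeq g) {F : Set X} {x y : X}
    {γ δ : C(unitInterval, X)} (hγ : γ ∈ canonPaths g F x y) (hδ : δ ∈ canonPaths g F x y)
    (hne : γ ≠ δ) : ∃ C ⊆ F, IsJordanCurve C := by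
  by_cases hxy : x = y
  · subst hxy
    exact absurd ((existsUnique_canonPaths_self hg (mem_of_mem_canonPaths hγ).1).unique hγ hδ) hne
  · obtain ⟨C, hC, hJ⟩ := (arcBetween_of_mem_canonPaths hγ hxy).exists_isJordanCurve
      (arcBetween_of_mem_canonPaths hδ hxy) fun h => hne (canonPaths_eq_of_range_eq hg hγ hδ h)
    exact ⟨C, hC.trans (union_subset hγ.2.2.2.2 hδ.2.2.2.2), hJ⟩

theorem IsJordanCurve.exists_canonPaths_ne (hg : IsSeparatingSeq g) {F C : Set X}
    (hC : IsJordanCurve C) (hCF : C ⊆ F) {x y : X} (hx : x ∈ C) (hy : y ∈ C) (hxy : x ≠ y) :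
    ∃ γ ∈ canonPaths g F x y, ∃ δ ∈ canonPaths g F x y, γ ≠ δ := by
  obtain ⟨A, hAC, B, hBC, hA, hB, hAB⟩ := hC.exists_arcBetween hx hy hxy
  obtain ⟨γ, hγ, hrγ⟩ := hA.exists_mem_canonPaths hg (hAC.trans hCF)
  obtain ⟨δ, hδ, hrδ⟩ := hB.exists_mem_canonPaths hg (hBC.trans hCF)
  refine ⟨γ, hγ, δ, hδ, ?_⟩
  rintro rfl
  rw [← hrγ, ← hrδ, inter_self, hrγ] at hAB
  exact hA.not_subset_pair hAB.subset

theorem isUniquelyJoined_iff (hg : IsSeparatingSeq g) {F : Set X} :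
    IsUniquelyJoined g F ↔ IsArcConnected F ∧ HasNoJordanCurve F := by
  constructor
  · refine fun h => ⟨h.isArcConnected hg, fun C hCF hC => ?_⟩
    obtain ⟨e⟩ := id hC
    have hne : (e 1 : X) ≠ e (-1) := fun h => Circle.neg_ne_self 1
      (e.injective (Subtype.ext h)).symm
    obtain ⟨γ, hγ, δ, hδ, hγδ⟩ := hC.exists_canonPaths_ne hg hCF (e 1).2 (e (-1)).2 hne
    exact hγδ ((h _ (hCF (e 1).2) _ (hCF (e (-1)).2)).unique hγ hδ)
  · rintro ⟨h, hJ⟩ x hx y hy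
    obtain ⟨γ, hγ⟩ := (mem_arcRel_iff hg).1 (h x hx y hy)
    refine ⟨γ, hγ, fun δ hδ => ?_⟩
    by_contra hne
    obtain ⟨C, hCF, hC⟩ := exists_isJordanCurve_of_canonPaths_ne hg hδ hγ hne
    exact hJ C hCF hC

/-- The curve is all of `F`, so it supplies two arcs between any two points; a third would create a
triod. Injectivity of `ι` lets exactly one ordering of the two paths count. -/
theorem IsArcConnected.isDoublyJoined_of_isJordanCurve (hg : IsSeparatingSeq g)
    {ι : C(unitInterval, X) → ℝ} (hι : Function.Injective ι) {F C : Set X} (hF : IsArcConnected F)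
    (hT : ∀ T ⊆ F, ¬ IsTriod T) (hC : IsJordanCurve C) (hCF : C ⊆ F) : IsDoublyJoined g ι F := by
  have hFC := hF.subset_of_isJordanCurve hT hC hCF
  intro x hx y hy hxy
  obtain ⟨γ, hγ, δ, hδ, hlt⟩ : ∃ γ ∈ canonPaths g F x y, ∃ δ ∈ canonPaths g F x y, ι γ < ι δ := by
    obtain ⟨γ, hγ, δ, hδ, hne⟩ := hC.exists_canonPaths_ne hg hCF (hFC hx) (hFC hy) hxy
    rcases lt_or_gt_of_ne (hι.ne hne) with h | h
    · exact ⟨γ, hγ, δ, hδ, h⟩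
    · exact ⟨δ, hδ, γ, hγ, h⟩
  have key : ∀ ε ∈ canonPaths g F x y, ε = γ ∨ ε = δ := by
    intro ε hε
    rcases (arcBetween_of_mem_canonPaths hγ hxy).eq_or_eq_of_no_triod hT
      (arcBetween_of_mem_canonPaths hδ hxy) (arcBetween_of_mem_canonPaths hε hxy) hγ.2.2.2.2
      hδ.2.2.2.2 hε.2.2.2.2
      (fun h => hlt.ne (congrArg ι (canonPaths_eq_of_range_eq hg hγ hδ h))) with h | h
    · exact .inl (canonPaths_eq_of_range_eq hg hε hγ h)
    · exact .inr (canonPaths_eq_of_range_eq hg hε hδ h)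
  refine ⟨(γ, δ), ⟨hγ, hδ, hlt⟩, ?_⟩
  rintro ⟨p, q⟩ ⟨hp, hq, hpq⟩
  rcases key p hp with rfl | rfl <;> rcases key q hq with rfl | rfl
  · exact absurd hpq (lt_irrefl _)
  · rfl
  · exact absurd hpq hlt.not_gt
  · exact absurd hpq (lt_irrefl _)

theorem IsArc.exists_arcBetween_of_mem_endpoints {J : Set X} (hJ : IsArc J) {c : X}
    (hc : c ∈ endpoints J) : ∃ y, ArcBetween J c y := by
  obtain ⟨a, b, hab⟩ : ∃ a b, ArcBetween J a b := by
    obtain ⟨h⟩ := hJ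
    have hr : range (fun t => (h t : X)) = J := by
      ext z
      exact ⟨fun ⟨t, ht⟩ => ht ▸ (h t).2, fun hz => ⟨h.symm ⟨z, hz⟩, by simp⟩⟩
    exact ⟨_, _, ⟨fun t => h t, by fun_prop⟩, Subtype.val_injective.comp h.injective, hr, rfl, rfl⟩
  rw [hab.endpoints_eq] at hc
  rcases hc with rfl | rfl
  · exact ⟨b, hab⟩
  · exact ⟨a, hab.symm⟩

/-- Rephrasing triods through paths starting at the centre makes their existence a projection of a
Borel set. -/
theorem exists_isTriod_subset_iff {F : Set X} :
    (∃ T ⊆ F, IsTriod T) ↔ ∃ γ : Fin 3 → C(unitInterval, X), (∀ i, Function.Injective (γ i)) ∧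
      (∀ i, range (γ i) ⊆ F) ∧ ∀ i j, i ≠ j →
        (γ i 0 = γ j 0 ∧ ∀ s t, γ i s = γ j t → s = 0 ∧ t = 0) := by
  constructor
  · rintro ⟨_, hTF, J, c, hJ, hinter, rfl⟩
    choose y γ hinj hr h0 h1 using fun i => (hJ i).1.exists_arcBetween_of_mem_endpoints (hJ i).2
    refine ⟨γ, hinj, fun i => (hr i).trans_subset ((subset_iUnion J i).trans hTF),
      fun i j hij => ⟨(h0 i).trans (h0 j).symm, fun s t hst => ?_⟩⟩
    have hc : γ i s ∈ ({c} : Set X) := by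
      rw [← hinter i j hij, ← hr, ← hr]
      exact ⟨mem_range_self _, hst ▸ mem_range_self _⟩
    have hs : γ i s = c := hc
    exact ⟨hinj i (hs.trans (h0 i).symm), hinj j (hst.symm.trans (hs.trans (h0 j).symm))⟩
  · rintro ⟨γ, hinj, hF, h⟩
    have harc : ∀ i, ArcBetween (range (γ i)) (γ 0 0) (γ i 1) := by
      intro i
      refine ⟨γ i, hinj i, rfl, ?_, rfl⟩
      by_cases hi : i = 0
      · rw [hi]
      · exact (h i 0 hi).1
    have hsub : ∀ i j, i ≠ j → range (γ i) ∩ range (γ j) ⊆ {γ 0 0} := by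
      rintro i j hij _ ⟨⟨s, rfl⟩, ⟨t, ht⟩⟩
      rw [((h i j hij).2 s t ht.symm).1]
      by_cases hi : i = 0
      · rw [hi]
        rfl
      · exact (h i 0 hi).1
    exact ⟨_, union_subset (union_subset (hF 0) (hF 1)) (hF 2), (harc 0).exists_isTriod (harc 1)
      (harc 2) (hsub 0 1 (by decide)) (hsub 0 2 (by decide)) (hsub 1 2 (by decide))⟩

theorem IsArcConnected.isAtriodic_iff {F : Set X} (hF : IsArcConnected F) :
    IsAtriodic F ↔ ∀ T ⊆ F, ¬ IsTriod T := by
  rw [IsAtriodic, triodicPart, ← not_iff_not, ← Ne, ← nonempty_iff_ne_empty]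
  push Not
  constructor
  · rintro ⟨z, hz⟩
    obtain ⟨x, ⟨-, T, hT, hTx⟩, -⟩ := mem_iUnion₂.1 hz
    refine ⟨T, fun y hy => ?_, hT⟩
    obtain ⟨J, hJ, hJF, he⟩ := hTx hy
    rcases isPDArc_and_endpoints_iff.1 ⟨hJ, he⟩ with h | ⟨rfl : x = y, rfl⟩
    · exact hJF h.right_mem
    · exact hJF rfl
  · rintro ⟨T, hTF, hT⟩
    obtain ⟨x, hx⟩ := hT.nonempty
    exact ⟨x, mem_iUnion₂.2 ⟨x, ⟨hTF hx, T, hT, fun y hy => hF x (hTF hx) y (hTF hy)⟩,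
      hF x (hTF hx) x (hTF hx)⟩⟩

theorem isArcConnected_and_isAtriodic_iff (hg : IsSeparatingSeq g) {ι : C(unitInterval, X) → ℝ}
    (hι : Function.Injective ι) {F : Set X} :
    IsArcConnected F ∧ IsAtriodic F ↔
      (∀ T ⊆ F, ¬ IsTriod T) ∧ (IsUniquelyJoined g F ∨ IsDoublyJoined g ι F) := by
  constructor
  · rintro ⟨hF, hT⟩
    rw [hF.isAtriodic_iff] at hT
    refine ⟨hT, ?_⟩
    by_cases hJ : HasNoJordanCurve F
    · exact .inl ((isUniquelyJoined_iff hg).2 ⟨hF, hJ⟩)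
    · simp only [HasNoJordanCurve, not_forall, not_not] at hJ
      obtain ⟨C, hCF, hC⟩ := hJ
      exact .inr (hF.isDoublyJoined_of_isJordanCurve hg hι hT hC hCF)
  · rintro ⟨hT, h⟩
    have hF : IsArcConnected F := h.elim (·.isArcConnected hg) (·.isArcConnected hg)
    exact ⟨hF, hF.isAtriodic_iff.2 hT⟩

end Families

end ArcConnected

namespace ArcConnected

/-! ### Complexity of the families and bianalytic liftings -/

section Complexity

variable {X : Type*} [TopologicalSpace X] [PolishSpace X] {g : ℕ → C(X, ℝ)}

theorem liftDomain_iff (hg : IsSeparatingSeq g) {G : Set (Closeds X)} {p : Closeds X × X × X} :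
    p ∈ liftDomain G ↔ p.1 ∈ G ∧ (canonPaths g (p.1 : Set X) p.2.1 p.2.2).Nonempty :=
  and_congr_right fun _ => mem_arcRel_iff hg

theorem carcNoJordan_eq (hg : IsSeparatingSeq g) :
    CarcNoJordan X = {F : Closeds X | IsUniquelyJoined g (F : Set X)} := by
  ext F
  exact (isUniquelyJoined_iff hg).symm

theorem carcAtriodic_eq (hg : IsSeparatingSeq g) {ι : C(unitInterval, X) → ℝ}
    (hι : Function.Injective ι) :
    CarcAtriodic X = {F : Closeds X | ∀ T ⊆ (F : Set X), ¬ IsTriod T} ∩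
      ({F : Closeds X | IsUniquelyJoined g (F : Set X)} ∪
        {F : Closeds X | IsDoublyJoined g ι (F : Set X)}) := by
  ext F
  exact isArcConnected_and_isAtriodic_iff hg hι

variable [MeasurableSpace X] [BorelSpace X]

/-- Membership in `F` is Borel, so the bounded quantifiers become quantifiers over all of `X`. -/
theorem isCoanalytic_forall_mem {A : Set (Closeds X × X × X)} (hA : IsCoanalytic A) :
    IsCoanalytic {F : Closeds X | ∀ x ∈ F, ∀ y ∈ F, (F, x, y) ∈ A} := by
  have hmem := measurableSet_mem_closeds (X := X)
  have h1 := (show Measurable fun p : Closeds X × X × X => (p.1, p.2.1) by fun_prop) hmem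
  have h2 := (show Measurable fun p : Closeds X × X × X => (p.1, p.2.2) by fun_prop) hmem
  convert! (((isCoanalytic_of_measurableSet h1.compl).union
    (isCoanalytic_of_measurableSet h2.compl)).union hA).forall_right using 1
  ext F
  simp only [mem_ofPred, mem_union, mem_compl_iff, mem_preimage, Prod.forall]
  refine forall_congr' fun x => ⟨fun h y => ?_, fun h hx y hy => ?_⟩
  · by_cases hx : x ∈ F
    · by_cases hy : y ∈ F
      · exact .inr (h hx y hy)
      · exact .inl (.inr hy)
    · exact .inl (.inl hx)
  · exact (h y).resolve_left (by simp [hx, hy])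

variable [MeasurableSpace C(unitInterval, X)] [BorelSpace C(unitInterval, X)]

theorem isCoanalytic_isUniquelyJoined (hg : IsSeparatingSeq g) :
    IsCoanalytic {F : Closeds X | IsUniquelyJoined g (F : Set X)} := by
  have := isPolish_pathSpace (X := X)
  exact isCoanalytic_forall_mem (isCoanalytic_existsUnique (measurableSet_canonPaths hg))

theorem measurableSet_canonPaths_lt (hg : IsSeparatingSeq g) {ι : C(unitInterval, X) → ℝ}
    (hι : Measurable ι) :
    MeasurableSet {q : (Closeds X × X × X) × C(unitInterval, X) × C(unitInterval, X) |
      q.2.1 ∈ canonPaths g (q.1.1 : Set X) q.1.2.1 q.1.2.2 ∧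
      q.2.2 ∈ canonPaths g (q.1.1 : Set X) q.1.2.1 q.1.2.2 ∧ ι q.2.1 < ι q.2.2} := by
  have hP := measurableSet_canonPaths hg
  have h1 := (show Measurable fun q : (Closeds X × X × X) × C(unitInterval, X) ×
    C(unitInterval, X) => (q.1, q.2.1) by fun_prop) hP
  have h2 := (show Measurable fun q : (Closeds X × X × X) × C(unitInterval, X) ×
    C(unitInterval, X) => (q.1, q.2.2) by fun_prop) hP
  exact h1.inter (h2.inter (measurableSet_lt
    (hι.comp (measurable_fst.comp measurable_snd)) (hι.comp (measurable_snd.comp measurable_snd))))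

theorem isCoanalytic_isDoublyJoined (hg : IsSeparatingSeq g) {ι : C(unitInterval, X) → ℝ}
    (hι : Measurable ι) : IsCoanalytic {F : Closeds X | IsDoublyJoined g ι (F : Set X)} := by
  have := isPolish_pathSpace (X := X)
  have heq : MeasurableSet {p : Closeds X × X × X | p.2.1 = p.2.2} :=
    measurableSet_eq_fun (by fun_prop) (by fun_prop)
  convert! isCoanalytic_forall_mem ((isCoanalytic_of_measurableSet heq).union
    (isCoanalytic_existsUnique (measurableSet_canonPaths_lt hg hι))) using 1
  ext F
  simp only [mem_ofPred, mem_union, IsDoublyJoined, ← or_iff_not_imp_left, SetLike.mem_coe]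

theorem isCoanalytic_no_triod :
    IsCoanalytic {F : Closeds X | ∀ T ⊆ (F : Set X), ¬ IsTriod T} := by
  have := isPolish_pathSpace (X := X)
  have h : {F : Closeds X | ∀ T ⊆ (F : Set X), ¬ IsTriod T}ᶜ =
      {F : Closeds X | ∃ γ : Fin 3 → C(unitInterval, X), (F, γ) ∈
        {q : Closeds X × (Fin 3 → C(unitInterval, X)) |
          (∀ i, Function.Injective (q.2 i)) ∧ (∀ i, range (q.2 i) ⊆ (q.1 : Set X)) ∧
          ∀ i j, i ≠ j →
            (q.2 i 0 = q.2 j 0 ∧ ∀ s t, q.2 i s = q.2 j t → s = 0 ∧ t = 0)}} := by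
    ext F
    simp only [mem_compl_iff, mem_ofPred, ← exists_isTriod_subset_iff]
    push Not
    rfl
  rw [IsCoanalytic, h]
  refine isAnalytic_exists ?_
  have happ : ∀ i, Measurable fun q : Closeds X × (Fin 3 → C(unitInterval, X)) => q.2 i :=
    fun i => by fun_prop
  have heval : Measurable fun γ : C(unitInterval, X) => γ 0 :=
    (show Continuous fun γ : C(unitInterval, X) => γ 0 by fun_prop).measurable
  refine measurableSet_setOfPred.2 (Measurable.and ?_ (Measurable.and ?_ ?_))
  · exact Measurable.forall fun i => measurableSet_setOfPred.1 (happ i measurableSet_injective)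
  · exact Measurable.forall fun i => measurableSet_setOfPred.1
      ((show Measurable fun q : Closeds X × (Fin 3 → C(unitInterval, X)) => (q.1, q.2 i) by
        fun_prop) measurableSet_range_subset)
  · refine Measurable.forall fun i => Measurable.forall fun j => measurable_const.imp
      (Measurable.and ?_ ?_)
    · exact measurableSet_setOfPred.1
        (measurableSet_eq_fun (heval.comp (happ i)) (heval.comp (happ j)))
    · exact measurableSet_setOfPred.1 (((happ i).prodMk (happ j)) measurableSet_meet_only_at_zero)

/-- An analytic set of canonical paths with singleton sections gives a bianalytic lifting. -/
theorem exists_bianalytic_lifting {G : Set (Closeds X)}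
    {Q : Set ((Closeds X × X × X) × C(unitInterval, X))} (hQ : IsAnalytic Q)
    (hcanon : ∀ p γ, (p, γ) ∈ Q → γ ∈ canonPaths g (p.1 : Set X) p.2.1 p.2.2)
    (huniq : ∀ p ∈ liftDomain G, ∃! γ, (p, γ) ∈ Q) :
    ∃ Ψ : liftDomain G → PDArcs X, IsUniformArcLifting G Ψ ∧ IsBianalyticMap Ψ := by
  have := isPolish_pathSpace (X := X)
  choose ψ hψ hψ' using huniq
  let Ψ : liftDomain G → PDArcs X := fun p =>
    ⟨rangeCompacts (ψ p p.2), (isPDArc_range_of_mem_canonPaths (hcanon _ _ (hψ p p.2))).1⟩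
  refine ⟨Ψ, fun p => ?_, fun U hU => ?_⟩
  · have h := hcanon _ _ (hψ p p.2)
    exact ⟨h.2.2.2.2, (isPDArc_range_of_mem_canonPaths h).2⟩
  · obtain ⟨V, hV, rfl⟩ := isOpen_induced_iff.1 hU
    have hVm : MeasurableSet {q : (Closeds X × X × X) × C(unitInterval, X) |
        rangeCompacts q.2 ∈ V} :=
      measurable_snd (hV.preimage continuous_rangeCompacts).measurableSet
    -- Because the section of `Q` is a singleton, the value lies in `V` exactly when some path in
    -- the section has its range in `V`.
    refine ⟨_, (hQ.inter (isAnalytic_of_measurableSet hVm)).exists_right, ?_⟩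
    ext p
    constructor
    · exact fun hp => ⟨ψ p p.2, hψ p p.2, hp⟩
    · rintro ⟨γ, hγ, hγV⟩
      obtain rfl := hψ' p p.2 γ hγ
      exact hγV

theorem exists_bianalytic_lifting_carcNoJordan (hg : IsSeparatingSeq g) :
    ∃ Ψ : liftDomain (CarcNoJordan X) → PDArcs X,
      IsUniformArcLifting (CarcNoJordan X) Ψ ∧ IsBianalyticMap Ψ := by
  have := isPolish_pathSpace (X := X)
  refine exists_bianalytic_lifting (g := g)
    (isAnalytic_of_measurableSet (measurableSet_canonPaths hg)) (fun p γ h => h) fun p hp => ?_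
  obtain ⟨hF, γ, hγ⟩ := (liftDomain_iff hg).1 hp
  rw [carcNoJordan_eq hg] at hF
  exact hF _ (mem_of_mem_canonPaths hγ).1 _ (mem_of_mem_canonPaths hγ).2

/-- The selecting set must be analytic. Not being doubly joined is analytic, and then, or when `x =
y`, the canonical path is unique. The alternative `L` picks the path with smaller `ι` and needs no
coanalytic side condition, since it has no members over points joined by a single path. -/
theorem exists_bianalytic_lifting_carcAtriodic (hg : IsSeparatingSeq g)
    {ι : C(unitInterval, X) → ℝ} (hι : Measurable ι) (hinj : Function.Injective ι) :
    ∃ Ψ : liftDomain (CarcAtriodic X) → PDArcs X,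
      IsUniformArcLifting (CarcAtriodic X) Ψ ∧ IsBianalyticMap Ψ := by
  have := isPolish_pathSpace (X := X)
  let P : Set ((Closeds X × X × X) × C(unitInterval, X)) :=
    {q | q.2 ∈ canonPaths g (q.1.1 : Set X) q.1.2.1 q.1.2.2}
  let S : Set ((Closeds X × X × X) × C(unitInterval, X)) :=
    {q | ¬ IsDoublyJoined g ι (q.1.1 : Set X)}
  let E : Set ((Closeds X × X × X) × C(unitInterval, X)) := {q | q.1.2.1 = q.1.2.2}
  let L : Set ((Closeds X × X × X) × C(unitInterval, X)) :=
    {q | ∃ δ, q.2 ∈ canonPaths g (q.1.1 : Set X) q.1.2.1 q.1.2.2 ∧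
      δ ∈ canonPaths g (q.1.1 : Set X) q.1.2.1 q.1.2.2 ∧ ι q.2 < ι δ}
  have hP : IsAnalytic P := isAnalytic_of_measurableSet (measurableSet_canonPaths hg)
  have hS : IsAnalytic S := IsAnalytic.preimage (isCoanalytic_isDoublyJoined hg hι)
    (f := fun q : (Closeds X × X × X) × C(unitInterval, X) => q.1.1) (by fun_prop)
  have hE : IsAnalytic E :=
    isAnalytic_of_measurableSet (measurableSet_eq_fun (by fun_prop) (by fun_prop))
  have hL : IsAnalytic L := isAnalytic_exists
    ((show Measurable fun q : ((Closeds X × X × X) × C(unitInterval, X)) × C(unitInterval, X) =>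
      (q.1.1, q.1.2, q.2) by fun_prop) (measurableSet_canonPaths_lt hg hι))
  refine exists_bianalytic_lifting (hP.inter ((hS.union hE).union hL)) (fun p γ h => h.1) ?_
  rintro ⟨F, x, y⟩ hp
  obtain ⟨hF, γ, hγ⟩ := (liftDomain_iff hg).1 hp
  obtain ⟨hx, hy⟩ := mem_of_mem_canonPaths hγ
  rw [carcAtriodic_eq hg hinj] at hF
  by_cases hxy : x = y
  · obtain rfl : x = y := hxy
    have h := existsUnique_canonPaths_self hg hx
    exact ⟨γ, ⟨hγ, .inl (.inr rfl)⟩, fun δ hδ => h.unique hδ.1 hγ⟩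
  by_cases hD : IsDoublyJoined g ι (F : Set X)
  · obtain ⟨⟨α, β⟩, ⟨hα, hβ, hlt⟩, huniq⟩ := hD x hx y hy hxy
    refine ⟨α, ⟨hα, .inr ⟨β, hα, hβ, hlt⟩⟩, ?_⟩
    rintro δ ⟨-, (h | h) | ⟨ε, hδ, hε, hδε⟩⟩
    · exact absurd hD h
    · exact absurd h hxy
    · exact congrArg Prod.fst (huniq (δ, ε) ⟨hδ, hε, hδε⟩)
  · have h := hF.2.resolve_right hD x hx y hy
    exact ⟨γ, ⟨hγ, .inl (.inl hD)⟩, fun δ hδ => h.unique hδ.1 hγ⟩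

end Complexity

end ArcConnected

/-! ### The corollary -/

open ArcConnected in
theorem mainTheorem7 (X : Type*) [TopologicalSpace X] [PolishSpace X]
    [MeasurableSpace X] [BorelSpace X] :
    (IsCoanalytic (CarcAtriodic X) ∧
      ∃ Ψ : liftDomain (CarcAtriodic X) → PDArcs X,
        IsUniformArcLifting (CarcAtriodic X) Ψ ∧ IsBianalyticMap Ψ) ∧
    (IsCoanalytic (CarcNoJordan X) ∧
      ∃ Ψ : liftDomain (CarcNoJordan X) → PDArcs X,
        IsUniformArcLifting (CarcNoJordan X) Ψ ∧ IsBianalyticMap Ψ) ∧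
    (IsAtriodic (univ : Set X) ∨ HasNoJordanCurve (univ : Set X) → IsCoanalytic (Carc X)) := by
  borelize C(unitInterval, X)
  have := isPolish_pathSpace (X := X)
  obtain ⟨g, hg⟩ := exists_isSeparatingSeq X
  -- This Borel injection orders the paths, so that one of two can be chosen in a Borel way.
  obtain ⟨ι, hι⟩ := MeasureTheory.exists_measurableEmbedding_real C(unitInterval, X)
  have ha : IsCoanalytic (CarcAtriodic X) := by
    rw [carcAtriodic_eq hg hι.injective]
    exact isCoanalytic_no_triod.inter
      ((isCoanalytic_isUniquelyJoined hg).union (isCoanalytic_isDoublyJoined hg hι.measurable))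
  have hb : IsCoanalytic (CarcNoJordan X) := by
    rw [carcNoJordan_eq hg]
    exact isCoanalytic_isUniquelyJoined hg
  refine ⟨⟨ha, exists_bianalytic_lifting_carcAtriodic hg hι.measurable hι.injective⟩,
    ⟨hb, exists_bianalytic_lifting_carcNoJordan hg⟩, ?_⟩
  rintro (h | h)
  · have : Carc X = CarcAtriodic X :=
      (sep_eq_self_iff_mem_true.2 fun F _ => h.mono (subset_univ _)).symm
    rwa [this]
  · have : Carc X = CarcNoJordan X :=
      (sep_eq_self_iff_mem_true.2 fun F _ C _ => h C (subset_univ _)).symm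
    rwa [this]
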